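/- Let $c>1$ be a constant. There are constants $0<\alpha<1<\beta$, depending only on $c$, such that the following holds. Let $d=d(n)$ satisfy $c\log n\le d\le \log^5 n$ for all sufficiently large $n$, and let $G=G(n,p)$ be the binomial random graph on $n$ vertices with $p=d/n$. Let $t^*=t^*(n)$ be the largest integer sequence with $d^{t^*}=o(n)$ (that is, $d^{t^*}=o(n)$, and every integer sequence $s=s(n)$ with $d^{s}=o(n)$ satisfies $s\le t^*$ for all large $n$); we assume that such a sequence exists. Put $\gamma=\gamma(n)=p\,d^{t^*}=d^{t^*+1}/n$. For a vertex $w$ and an integer $t \ge 0$ let $V_t(w)$ be the set of vertices at distance exactly $t$ from $w$. "W.h.p." means with probability tending to $1$ as $n\to\infty$, and the $o(1)$ terms are uniform in $w$ and $t$. The constants $\alpha,\beta$ are such that w.h.p. for all vertices $w$ and all $1\le t\le t^*$ $$(1-o(1))\,\alpha d^t\le |V_t(w)|\le (1+o(1))\,\beta d^t$$ (for $t=1$ this reads $(1-o(1))\alpha d\le\deg w\le(1+o(1))\beta d$), and: **Case 1:** if $\gamma=\Theta(1)$, then w.h.p. for all vertices $w$ $$1-e^{-\alpha\gamma}-o(1)\le\frac{|V_{t^*+1}(w)|}{n}\le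 1-e^{-\beta\gamma}+o(1),$$ $$e^{-\beta\gamma}-o(1)\le\frac{|V_{t^*+2}(w)|}{n}\le e^{-\alpha\gamma}+o(1),$$ $$\frac{|V_{t^*+1}(w)|}{n}+\frac{|V_{t^*+2}(w)|}{n}=1-o(1).$$ **Case 2:** if $\gamma=\omega(1)$, then w.h.p. for all vertices $w$ $$\frac{|V_{t^*+1}(w)|}{n}\ge 1-(1+o(1))\left(\frac{\beta\gamma}{d}+e^{-\alpha\gamma}\right).$$ Moreover, if $d=\omega(\log n)$, then the shell-growth bound and Case 1 hold with $\alpha=\beta=1$, and Case 2 holds with $\beta=1$ and every constant $0<\alpha<1$. -/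

import Mathlib

open Filter Topology Asymptotics

namespace RandomShells

/-- The real number `x` as an edge probability. It is `x` itself when `0 ≤ x ≤ 1`, and is
truncated to `[0, 1]` otherwise (for `x = d / n` this matters for finitely many `n` only). -/
noncomputable def edgeProb (x : ℝ) : unitInterval :=
  Set.projIcc 0 1 zero_le_one x

/-- The event `E n` has probability tending to `1` in `G(n, p)` with `p = d n / n`, that is,
`E` holds with high probability. -/
def WHP (d : ℕ → ℝ) (E : (n : ℕ) → SimpleGraph (Fin n) → Prop) : Prop :=
  Tendsto
    (fun n : ℕ =>
      (SimpleGraph.binomialRandom (Fin n) (edgeProb (d n / (n : ℝ)))).real {G | E n G})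
    atTop (𝓝 1)

/-- The shell `V_t(w)`: the vertices at distance exactly `t` from `w`. The distance is the
extended one, so vertices in other components lie in no shell. -/
def shell {V : Type*} (G : SimpleGraph V) (w : V) (t : ℕ) : Set V :=
  {v | G.edist v w = (t : ℕ∞)}

/-- The fraction `|V_t(w)| / n` of the vertices that lie in the shell `V_t(w)`. -/
noncomputable def shellFraction {n : ℕ} (G : SimpleGraph (Fin n)) (w : Fin n) (t : ℕ) : ℝ :=
  ((shell G w t).ncard : ℝ) / (n : ℝ)

/-- `t = t(n)` is the largest integer sequence such that `d ^ t = o(n)`: it has this property, and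
every other sequence with this property is eventually at most `t`. -/
def IsLargestExponent (d : ℕ → ℝ) (t : ℕ → ℕ) : Prop :=
  ((fun n : ℕ => d n ^ t n) =o[atTop] fun n : ℕ => (n : ℝ)) ∧
    ∀ s : ℕ → ℕ, ((fun n : ℕ => d n ^ s n) =o[atTop] fun n : ℕ => (n : ℝ)) →
      ∀ᶠ n in atTop, s n ≤ t n

/-- `γ(n) = p d ^ t = d ^ (t + 1) / n`. -/
noncomputable def gam (d : ℕ → ℝ) (t : ℕ → ℕ) (n : ℕ) : ℝ :=
  d n ^ (t n + 1) / (n : ℝ)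

/-- W.h.p. `(1 - o(1)) α d ^ s ≤ |V_s(w)| ≤ (1 + o(1)) β d ^ s` for all vertices `w` and all
`1 ≤ s ≤ t`. For `s = 1` this is the bound `(1 - o(1)) α d ≤ deg w ≤ (1 + o(1)) β d`. -/
def ShellGrowth (α β : ℝ) (d : ℕ → ℝ) (t : ℕ → ℕ) : Prop :=
  ∀ ε : ℝ, 0 < ε → WHP d fun n G => ∀ w : Fin n, ∀ s : ℕ, 1 ≤ s → s ≤ t n →
    (1 - ε) * α * d n ^ s ≤ ((shell G w s).ncard : ℝ) ∧
      ((shell G w s).ncard : ℝ) ≤ (1 + ε) * β * d n ^ s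

/-- W.h.p., for all vertices `w`, up to errors `o(1)` that are uniform in `w`, the shells
`V_{t+1}(w)` and `V_{t+2}(w)` have fractions in `[1 - e^{-αγ}, 1 - e^{-βγ}]` and
`[e^{-βγ}, e^{-αγ}]` respectively, and these two fractions add up to `1`. -/
def TwoLastShells (α β : ℝ) (d : ℕ → ℝ) (t : ℕ → ℕ) : Prop :=
  ∀ ε : ℝ, 0 < ε → WHP d fun n G => ∀ w : Fin n,
    (1 - Real.exp (-(α * gam d t n)) - ε ≤ shellFraction G w (t n + 1) ∧
      shellFraction G w (t n + 1) ≤ 1 - Real.exp (-(β * gam d t n)) + ε) ∧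
    (Real.exp (-(β * gam d t n)) - ε ≤ shellFraction G w (t n + 2) ∧
      shellFraction G w (t n + 2) ≤ Real.exp (-(α * gam d t n)) + ε) ∧
    |shellFraction G w (t n + 1) + shellFraction G w (t n + 2) - 1| ≤ ε

/-- W.h.p. `|V_{t+1}(w)| / n ≥ 1 - (1 + o(1)) (βγ / d + e^{-αγ})` for all vertices `w`. -/
def OneLastShell (α β : ℝ) (d : ℕ → ℝ) (t : ℕ → ℕ) : Prop :=
  ∀ ε : ℝ, 0 < ε → WHP d fun n G => ∀ w : Fin n,
    1 - (1 + ε) * (β * gam d t n / d n + Real.exp (-(α * gam d t n))) ≤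
      shellFraction G w (t n + 1)

end RandomShells

/-!
Explore `G(n, p)` from `w` by breadth-first search. Knowing the first `s` shells reveals nothing
about the pairs between `V_s(w)` and the unexplored vertices, so an unexplored vertex joins
`V_{s+1}(w)` independently of the others, with probability `1 - (1 - p) ^ |V_s(w)|`. Bernstein's
inequality, with a union bound over `w` and `s`, therefore controls all shells at once.

While `d ^ s = o(n)`, the conditional mean of `|V_{s+1}(w)|` is `d |V_s(w)|` up to a relative error
`O(d ^ (s + 1) / n)`, caused by collisions and explored vertices, and the fluctuations have relative
size `O(d ^ (-s / 2))`. Both errors sum geometrically over `s < t` to `o(1)`, so bounds `α d` and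
`β d` on the degrees propagate to `α d ^ s` and `β d ^ s` for every `s ≤ t`. The lower degree bound
is a Chernoff estimate, in which `c > 1` makes the union bound over `w` converge.

At depth `t` almost all vertices are still unexplored. One more step keeps a fraction
`(1 - p) ^ |V_t(w)|` of them, which is about `exp (-p |V_t(w)|)`. If `γ` is bounded below, then
`V_{t+1}(w)` has linear size and the step after that keeps only a fraction `exp (-Ω(d))`.
-/

namespace RandomShells

open MeasureTheory ProbabilityTheory
open scoped SimpleGraph

section EdgeIndependence

variable {V : Type*} {I J : Set (Sym2 V)} {E F : Set (SimpleGraph V)}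

/-- The event `E` on graphs is determined by which pairs in `I` are edges. -/
def DependsOnEdges (I : Set (Sym2 V)) (E : Set (SimpleGraph V)) : Prop :=
  ∀ G H : SimpleGraph V, (∀ e ∈ I, e ∈ G.edgeSet ↔ e ∈ H.edgeSet) → G ∈ E → H ∈ E

lemma DependsOnEdges.compl (hE : DependsOnEdges I E) : DependsOnEdges I Eᶜ :=
  fun G H hGH hG hH => hG (hE H G (fun e he => (hGH e he).symm) hH)

lemma DependsOnEdges.inter (hE : DependsOnEdges I E) (hF : DependsOnEdges J F) :
    DependsOnEdges (I ∪ J) (E ∩ F) :=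
  fun G H hGH hG => ⟨hE G H (fun e he => hGH e (.inl he)) hG.1,
    hF G H (fun e he => hGH e (.inr he)) hG.2⟩

lemma dependsOnEdges_adj (v u : V) : DependsOnEdges {s(v, u)} {G | G.Adj v u} :=
  fun _ _ hGH hG => (hGH s(v, u) rfl).1 hG

lemma DependsOnEdges.preimage_image [Fintype I] (hE : DependsOnEdges I E) :
    (fun (G : SimpleGraph V) (e : I.toFinset) => (e : Sym2 V) ∈ G.edgeSet) ⁻¹'
      ((fun (G : SimpleGraph V) (e : I.toFinset) => (e : Sym2 V) ∈ G.edgeSet) '' E) = E := by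
  refine Set.Subset.antisymm ?_ (Set.subset_preimage_image _ _)
  rintro H ⟨G, hG, hGH⟩
  exact hE G H (fun e he => iff_of_eq (congrFun hGH ⟨e, by simpa using he⟩)) hG

variable [Finite V]

instance : MeasurableSingletonClass (SimpleGraph V) where
  measurableSet_singleton G := by
    have hpreimage : {G} = SimpleGraph.edgeSet ⁻¹' {G.edgeSet} := by ext; simp
    rw [hpreimage]
    exact SimpleGraph.measurable_edgeSet .of_discrete

variable (p : unitInterval)

lemma map_mem_edgeSet_binomialRandom :
    G(V, p).map (fun G (e : Sym2 V) => e ∈ G.edgeSet) =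
      Measure.infinitePi fun e : Sym2 V =>
        (unitInterval.toNNReal p • Measure.dirac (e ∈ (Sym2.diagSetᶜ : Set (Sym2 V)))
          + unitInterval.toNNReal (unitInterval.symm p) • Measure.dirac False : Measure Prop) := by
  have hmem : Measurable (fun (s : Set (Sym2 V)) (e : Sym2 V) => e ∈ s) := by fun_prop
  have hedge : G(V, p).map SimpleGraph.edgeSet = setBernoulli (Sym2.diagSetᶜ : Set (Sym2 V)) p := by
    rw [SimpleGraph.binomialRandom, SimpleGraph.measurableEmbedding_edgeSet.map_comap]
    refine Measure.restrict_eq_self_of_ae_mem ?_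
    filter_upwards [setBernoulli_ae_subset] with s hs
    exact ⟨.fromEdgeSet s, by simpa [← Set.disjoint_compl_right_iff_subset] using hs⟩
  calc G(V, p).map (fun G (e : Sym2 V) => e ∈ G.edgeSet)
      = (G(V, p).map SimpleGraph.edgeSet).map fun s e => e ∈ s :=
        (Measure.map_map hmem SimpleGraph.measurable_edgeSet).symm
    _ = _ := by
        rw [hedge, setBernoulli_eq_map, Measure.map_map hmem (by fun_prop)]
        exact Measure.map_id

lemma map_mem_edgeSet_apply_binomialRandom (e : Sym2 V) :
    G(V, p).map (fun G => e ∈ G.edgeSet) =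
      unitInterval.toNNReal p • Measure.dirac (e ∈ (Sym2.diagSetᶜ : Set (Sym2 V)))
        + unitInterval.toNNReal (unitInterval.symm p) • Measure.dirac False := by
  have heval := congrArg (Measure.map fun f : Sym2 V → Prop => f e)
    (map_mem_edgeSet_binomialRandom (V := V) p)
  rwa [Measure.map_map (by fun_prop) .of_discrete, Measure.infinitePi_map_eval] at heval

lemma iIndepFun_mem_edgeSet :
    iIndepFun (fun (e : Sym2 V) (G : SimpleGraph V) => e ∈ G.edgeSet) G(V, p) := by
  rw [iIndepFun_iff_map_fun_eq_infinitePi_map (fun e => .of_discrete),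
    map_mem_edgeSet_binomialRandom]
  exact congrArg _ (funext fun e => (map_mem_edgeSet_apply_binomialRandom p e).symm)

lemma binomialRandom_real_adj {v u : V} (hvu : v ≠ u) : G(V, p).real {G | G.Adj v u} = p := by
  have hpreimage : {G : SimpleGraph V | G.Adj v u} = (fun G => s(v, u) ∈ G.edgeSet) ⁻¹' {True} := by
    ext; simp
  rw [hpreimage, ← map_measureReal_apply .of_discrete .of_discrete,
    map_mem_edgeSet_apply_binomialRandom]
  simp [measureReal_def, hvu]

lemma DependsOnEdges.measure_inter (hE : DependsOnEdges I E) (hF : DependsOnEdges J F)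
    (hIJ : Disjoint I J) : G(V, p) (E ∩ F) = G(V, p) E * G(V, p) F := by
  classical
  have := Fintype.ofFinite V
  have hindep := ((iIndepFun_mem_edgeSet (V := V) p).indepFun_finset I.toFinset J.toFinset
    (by simpa using hIJ) fun e => .of_discrete).measure_inter_preimage_eq_mul
      ((fun G (e : I.toFinset) => (e : Sym2 V) ∈ G.edgeSet) '' E)
      ((fun G (e : J.toFinset) => (e : Sym2 V) ∈ G.edgeSet) '' F) .of_discrete .of_discrete
  rwa [hE.preimage_image, hF.preimage_image] at hindep

lemma iIndepSet_of_dependsOnEdges {ι : Type*} {J : ι → Set (Sym2 V)} {F : ι → Set (SimpleGraph V)}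
    (hF : ∀ i, DependsOnEdges (J i) (F i)) (hJ : Pairwise (Function.onFun Disjoint J)) :
    iIndepSet F G(V, p) := by
  classical
  rw [iIndepSet_iff_meas_biInter (fun i => .of_discrete)]
  intro s
  suffices DependsOnEdges (⋃ i ∈ s, J i) (⋂ i ∈ s, F i) ∧
      G(V, p) (⋂ i ∈ s, F i) = ∏ i ∈ s, G(V, p) (F i) from this.2
  induction s using Finset.induction_on with
  | empty => exact ⟨fun _ _ _ _ => by simp, by simp⟩
  | insert a s ha ih =>
    have hdisjoint : Disjoint (J a) (⋃ i ∈ s, J i) :=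
      Set.disjoint_iUnion₂_right.2 fun i hi => hJ fun h => ha (h ▸ hi)
    rw [Finset.set_biUnion_insert, Finset.set_biInter_insert, Finset.prod_insert ha, ← ih.2]
    exact ⟨(hF a).inter ih.1, (hF a).measure_inter p ih.1 hdisjoint⟩

lemma binomialRandom_real_exists_adj {v : V} {S : Set V} (hv : v ∉ S) :
    G(V, p).real {G | ∃ u ∈ S, G.Adj v u} = 1 - (1 - p : ℝ) ^ S.ncard := by
  classical
  have := Fintype.ofFinite V
  have hindep := iIndepSet_of_dependsOnEdges p
    (F := fun u => {G : SimpleGraph V | G.Adj v u}ᶜ) (fun u => (dependsOnEdges_adj v u).compl)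
    fun u u' huu' => Set.disjoint_singleton.2 (huu' ∘ Sym2.congr_right.1)
  have hcompl : {G : SimpleGraph V | ∃ u ∈ S, G.Adj v u}ᶜ =
      ⋂ u ∈ S.toFinset, {G | G.Adj v u}ᶜ := by
    ext; simp
  have hprob : G(V, p).real {G | ∃ u ∈ S, G.Adj v u}ᶜ = (1 - p : ℝ) ^ S.ncard := by
    rw [hcompl, measureReal_def, hindep.meas_biInter, ENNReal.toReal_prod,
      Set.ncard_eq_toFinset_card', ← Finset.prod_const]
    refine Finset.prod_congr rfl fun u hu => ?_
    rw [← measureReal_def, probReal_compl_eq_one_sub .of_discrete, binomialRandom_real_adj]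
    exact fun h => hv (h ▸ Set.mem_toFinset.1 hu)
  rw [probReal_compl_eq_one_sub .of_discrete] at hprob
  linarith

end EdgeIndependence

section Concentration

variable {Ω ι : Type*} [MeasurableSpace Ω] {μ : Measure Ω} [IsProbabilityMeasure μ] {l : ℝ}

lemma mgf_le_exp_sq_mul_variance {X : Ω → ℝ} (hmeas : AEMeasurable X μ)
    (hbound : ∀ᵐ ω ∂μ, |X ω| ≤ 1) (hmean : μ[X] = 0) (hl : |l| ≤ 1) :
    mgf X μ l ≤ Real.exp (l ^ 2 * Var[X; μ]) := by
  have hint_X : Integrable X μ := .of_bound hmeas.aestronglyMeasurable 1 hbound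
  have hint : Integrable (fun ω => 1 + l * X ω) μ :=
    (integrable_const 1).add (hint_X.const_mul l)
  have hint_sq : Integrable (fun ω => X ω ^ 2) μ :=
    .of_bound (hmeas.pow_const 2).aestronglyMeasurable 1
      (hbound.mono fun ω h => by simpa using h)
  have hpointwise : ∀ᵐ ω ∂μ, Real.exp (l * X ω) ≤ 1 + l * X ω + l ^ 2 * X ω ^ 2 := by
    filter_upwards [hbound] with ω hω
    have hlX : |l * X ω| ≤ 1 := by rw [abs_mul]; exact mul_le_one₀ hl (abs_nonneg _) hω
    linarith [le_of_abs_le (Real.abs_exp_sub_one_sub_id_le hlX), mul_pow l (X ω) 2]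
  calc mgf X μ l ≤ ∫ ω, (1 + l * X ω + l ^ 2 * X ω ^ 2) ∂μ :=
        integral_mono_ae (integrable_exp_mul_of_mem_Icc hmeas (hbound.mono fun ω h => abs_le.1 h))
          (hint.add (hint_sq.const_mul _)) hpointwise
    _ = l ^ 2 * Var[X; μ] + 1 := by
        rw [integral_add hint (hint_sq.const_mul _),
          integral_add (integrable_const 1) (hint_X.const_mul l), integral_const_mul,
          integral_const_mul, hmean, variance_of_integral_eq_zero hmeas hmean]
        simp [add_comm]
    _ ≤ Real.exp (l ^ 2 * Var[X; μ]) := Real.add_one_le_exp _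

variable [Fintype ι]

lemma bernstein_le_sum {X : ι → Ω → ℝ} (hindep : iIndepFun X μ) (hmeas : ∀ i, Measurable (X i))
    (hbound : ∀ i, ∀ᵐ ω ∂μ, |X i ω| ≤ 1) (hmean : ∀ i, μ[X i] = 0) (hl0 : 0 ≤ l) (hl1 : l ≤ 1)
    (y : ℝ) :
    μ.real {ω | l * ∑ i, Var[X i; μ] + y ≤ ∑ i, X i ω} ≤ Real.exp (-(l * y)) := by
  have hint : Integrable (fun ω => Real.exp (l * (∑ i, X i) ω)) μ :=
    hindep.integrable_exp_mul_sum hmeas fun i _ => integrable_exp_mul_of_mem_Icc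
      (hmeas i).aemeasurable ((hbound i).mono fun ω h => abs_le.1 h)
  have hmgf : mgf (∑ i, X i) μ l ≤ Real.exp (l ^ 2 * ∑ i, Var[X i; μ]) := by
    rw [hindep.mgf_sum hmeas, Finset.mul_sum, Real.exp_sum]
    exact Finset.prod_le_prod (fun i _ => mgf_nonneg) fun i _ => mgf_le_exp_sq_mul_variance
      (hmeas i).aemeasurable (hbound i) (hmean i) (abs_le.2 ⟨by linarith, hl1⟩)
  have hchernoff := measure_ge_le_exp_mul_mgf (l * ∑ i, Var[X i; μ] + y) hl0 hint
  simp only [Finset.sum_apply] at hchernoff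
  refine hchernoff.trans ((mul_le_mul_of_nonneg_left hmgf (Real.exp_nonneg _)).trans_eq ?_)
  rw [← Real.exp_add]
  ring_nf

lemma bernstein_le_abs_sum {X : ι → Ω → ℝ} (hindep : iIndepFun X μ) (hmeas : ∀ i, Measurable (X i))
    (hbound : ∀ i, ∀ᵐ ω ∂μ, |X i ω| ≤ 1) (hmean : ∀ i, μ[X i] = 0) (hl0 : 0 ≤ l) (hl1 : l ≤ 1)
    (y : ℝ) :
    μ.real {ω | l * ∑ i, Var[X i; μ] + y ≤ |∑ i, X i ω|} ≤ 2 * Real.exp (-(l * y)) := by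
  have hneg := bernstein_le_sum (hindep.comp (fun _ x => -x) fun _ => measurable_neg)
    (fun i => (hmeas i).neg) (fun i => by simpa using hbound i)
    (fun i => by simp [integral_neg, hmean i]) hl0 hl1 y
  have hvar : ∀ i, Var[(fun x => -x) ∘ X i; μ] = Var[X i; μ] := fun i => variance_fun_neg
  simp only [hvar, Function.comp_apply, Finset.sum_neg_distrib] at hneg
  simp only [le_abs, Set.ofPred_or, two_mul]
  exact (measureReal_union_le _ _).trans
    (add_le_add (bernstein_le_sum hindep hmeas hbound hmean hl0 hl1 y) hneg)

variable {F : ι → Set Ω}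

lemma variance_indicator_one {A : Set Ω} (hA : MeasurableSet A) :
    Var[A.indicator (fun _ => (1 : ℝ)); μ] = μ.real A * (1 - μ.real A) := by
  have hsq : A.indicator (fun _ => (1 : ℝ)) ^ 2 = A.indicator fun _ => 1 := by
    ext ω; by_cases hω : ω ∈ A <;> simp [hω]
  rw [variance_eq_sub (memLp_indicator_const 2 hA 1 (.inr (measure_ne_top μ A))), hsq,
    integral_indicator_const _ hA]
  simp
  ring

lemma bernstein_le_abs_sum_indicator_sub (hindep : iIndepSet F μ) (hF : ∀ i, MeasurableSet (F i))
    (hl0 : 0 ≤ l) (hl1 : l ≤ 1) (y : ℝ) :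
    μ.real {ω | l * ∑ i, μ.real (F i) * (1 - μ.real (F i)) + y ≤
      |∑ i, (F i).indicator (fun _ => (1 : ℝ)) ω - ∑ i, μ.real (F i)|} ≤
      2 * Real.exp (-(l * y)) := by
  have hmeas : ∀ i, Measurable ((F i).indicator fun _ => (1 : ℝ)) :=
    fun i => measurable_const.indicator (hF i)
  have hcentred : iIndepFun (fun i ω => (F i).indicator (fun _ => (1 : ℝ)) ω - μ.real (F i)) μ :=
    hindep.iIndepFun_indicator.comp (fun i x => x - μ.real (F i)) fun i =>
      measurable_id.sub_const _
  have hbound : ∀ i ω, |(F i).indicator (fun _ => (1 : ℝ)) ω - μ.real (F i)| ≤ 1 := fun i ω =>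
    abs_sub_le_of_nonneg_of_le (Set.indicator_nonneg (fun _ _ => zero_le_one) ω)
      (Set.indicator_le_self' (fun _ _ => zero_le_one) ω) measureReal_nonneg measureReal_le_one
  have hbernstein := bernstein_le_abs_sum hcentred (fun i => (hmeas i).sub_const _)
    (fun i => .of_forall (hbound i)) (fun i => ?_) hl0 hl1 y
  · have hvar : ∀ i, Var[fun ω => (F i).indicator (fun _ => (1 : ℝ)) ω - μ.real (F i); μ] =
        μ.real (F i) * (1 - μ.real (F i)) := fun i => by
      rw [variance_sub_const (hmeas i).aestronglyMeasurable, variance_indicator_one (hF i)]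
    simpa only [hvar, Finset.sum_sub_distrib] using hbernstein
  · rw [integral_sub ((integrable_const _).indicator (hF i)) (integrable_const _),
      integral_indicator_const _ (hF i)]
    simp

lemma mgf_indicator_one {A : Set Ω} (hA : MeasurableSet A) (l : ℝ) :
    mgf (A.indicator fun _ => (1 : ℝ)) μ l = 1 + μ.real A * (Real.exp l - 1) := by
  have hexp : (fun ω => Real.exp (l * A.indicator (fun _ => (1 : ℝ)) ω)) =
      fun ω => 1 + A.indicator (fun _ => Real.exp l - 1) ω := by
    ext ω; by_cases hω : ω ∈ A <;> simp [hω]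
  rw [mgf, hexp, integral_add (integrable_const _) ((integrable_const _).indicator hA),
    integral_indicator_const _ hA]
  simp

lemma chernoff_sum_indicator_le (hindep : iIndepSet F μ) (hF : ∀ i, MeasurableSet (F i))
    (hl : 0 ≤ l) (y : ℝ) :
    μ.real {ω | ∑ i, (F i).indicator (fun _ => (1 : ℝ)) ω ≤ y} ≤
      Real.exp ((∑ i, μ.real (F i)) * (Real.exp (-l) - 1) + l * y) := by
  have hmeas : ∀ i, Measurable ((F i).indicator fun _ => (1 : ℝ)) :=
    fun i => measurable_const.indicator (hF i)
  have hindepFun : iIndepFun (fun i => (F i).indicator fun _ => (1 : ℝ)) μ :=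
    hindep.iIndepFun_indicator
  have hint := hindepFun.integrable_exp_mul_sum (t := -l) (s := Finset.univ) hmeas fun i _ =>
    integrable_exp_mul_of_mem_Icc (a := 0) (b := 1) (hmeas i).aemeasurable <| .of_forall fun ω =>
      ⟨Set.indicator_nonneg (fun _ _ => zero_le_one) ω,
        Set.indicator_le_self' (fun _ _ => zero_le_one) ω⟩
  have hmgf : mgf (∑ i, (F i).indicator fun _ => (1 : ℝ)) μ (-l) ≤
      Real.exp ((∑ i, μ.real (F i)) * (Real.exp (-l) - 1)) := by
    rw [hindepFun.mgf_sum hmeas, Finset.sum_mul, Real.exp_sum]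
    refine Finset.prod_le_prod (fun i _ => mgf_nonneg) fun i _ => ?_
    rw [mgf_indicator_one (hF i), add_comm]
    exact Real.add_one_le_exp _
  have hchernoff := measure_le_le_exp_mul_mgf y (neg_nonpos.2 hl) hint
  simp only [Finset.sum_apply, neg_neg] at hchernoff
  refine hchernoff.trans ((mul_le_mul_of_nonneg_left hmgf (Real.exp_nonneg _)).trans_eq ?_)
  rw [← Real.exp_add, add_comm]

end Concentration

section Exploration

variable {V : Type*} {G : SimpleGraph V} {w : V} {s : ℕ} {B S : Set V}

/-- The vertices at distance greater than `s` from `w`, including those in other components: the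
part of the graph left unexplored by a breadth-first search stopped at depth `s`. -/
def beyond (G : SimpleGraph V) (w : V) (s : ℕ) : Set V :=
  {v | (s : ℕ∞) < G.edist v w}

/-- The shell a breadth-first search finds next, when its last shell is `S` and the unexplored
vertices are `B`. -/
def nextShell (G : SimpleGraph V) (B S : Set V) : Set V :=
  {v ∈ B | ∃ u ∈ S, G.Adj v u}

lemma shell_zero : shell G w 0 = {w} := by
  ext; simp [shell]

lemma beyond_zero : beyond G w 0 = {w}ᶜ := by
  ext; simp [beyond, pos_iff_ne_zero]

lemma disjoint_beyond_shell : Disjoint (beyond G w s) (shell G w s) :=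
  Set.disjoint_left.2 fun _ hbeyond hshell => (ne_of_gt hbeyond) hshell

lemma mem_shell_succ {v : V} :
    v ∈ shell G w (s + 1) ↔ v ∈ beyond G w s ∧ G.edist v w ≤ (s + 1 : ℕ) := by
  rw [shell, beyond, Set.mem_ofPred_eq, Set.mem_ofPred_eq, le_antisymm_iff, and_comm]
  refine and_congr_left fun _ => ?_
  rw [Nat.cast_add, Nat.cast_one, ENat.add_one_le_iff (ENat.natCast_ne_top s)]

lemma beyond_succ : beyond G w (s + 1) = beyond G w s \ shell G w (s + 1) := by
  ext v
  rw [Set.mem_sdiff, mem_shell_succ, not_and, not_le]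
  refine ⟨fun hv => ⟨?_, fun _ => hv⟩, fun hv => hv.2 hv.1⟩
  exact lt_trans (Nat.cast_lt.2 s.lt_succ_self) (show ((s + 1 : ℕ) : ℕ∞) < G.edist v w from hv)

lemma edist_le_add_one_of_adj {u v : V} (h : G.Adj v u) : G.edist v w ≤ G.edist u w + 1 :=
  SimpleGraph.edist_triangle.trans_eq
    (by rw [SimpleGraph.edist_eq_one_iff_adj.2 h, add_comm])

lemma shell_succ : shell G w (s + 1) = nextShell G (beyond G w s) (shell G w s) := by
  ext v
  rw [mem_shell_succ]
  refine and_congr_right fun hv => ⟨fun hle => ?_, fun ⟨u, hu, hadj⟩ => ?_⟩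
  · obtain ⟨path, hlength⟩ := SimpleGraph.exists_walk_of_edist_ne_top
      (ne_top_of_le_ne_top (ENat.natCast_ne_top _) hle)
    cases path with
    | nil => simp [beyond] at hv
    | @cons _ u _ hadj tail =>
      rw [← hlength, SimpleGraph.Walk.length_cons, Nat.cast_le] at hle
      refine ⟨u, le_antisymm ((SimpleGraph.edist_le tail).trans ?_) ?_, hadj⟩
      · exact_mod_cast Nat.le_of_succ_le_succ hle
      · exact Order.le_of_lt_add_one (lt_of_lt_of_le hv (edist_le_add_one_of_adj hadj))
  · exact (edist_le_add_one_of_adj hadj).trans_eq (by rw [show G.edist u w = s from hu]; rfl)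

lemma shell_succ_subset_beyond : shell G w (s + 1) ⊆ beyond G w s :=
  fun _ hv => (mem_shell_succ.1 hv).1

lemma nextShell_congr {H : SimpleGraph V}
    (h : ∀ v ∈ B, ∀ u ∈ S, s(v, u) ∈ G.edgeSet ↔ s(v, u) ∈ H.edgeSet) :
    nextShell G B S = nextShell H B S :=
  Set.ext fun v => and_congr_right fun hv => exists_congr fun u => and_congr_right fun hu =>
    h v hv u hu

lemma dependsOnEdges_nextShell (P : Set V → Prop) :
    DependsOnEdges {e | ∃ v ∈ B, ∃ u ∈ S, e = s(v, u)} {G | P (nextShell G B S)} := by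
  intro G H hGH hG
  rwa [Set.mem_ofPred_eq, ← nextShell_congr fun v hv u hu => hGH _ ⟨v, hv, u, hu, rfl⟩]

lemma dependsOnEdges_beyond_shell (w : V) (s : ℕ) (B S : Set V) :
    DependsOnEdges {e | ∃ a ∉ B ∪ S, a ∈ e} {G | beyond G w s = B ∧ shell G w s = S} := by
  rintro G H hGH ⟨rfl, rfl⟩
  induction s with
  | zero => simp only [Set.mem_ofPred_eq, beyond_zero, shell_zero, and_self]
  | succ s ih =>
    have hunexplored : beyond G w (s + 1) ∪ shell G w (s + 1) = beyond G w s := by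
      rw [beyond_succ, Set.sdiff_union_of_subset shell_succ_subset_beyond]
    rw [hunexplored] at hGH
    obtain ⟨hbeyond, hshell⟩ := ih fun e ⟨a, ha, hae⟩ => hGH e ⟨a, fun h => ha (.inl h), hae⟩
    have hshell_succ : shell H w (s + 1) = shell G w (s + 1) := by
      rw [shell_succ, shell_succ, hbeyond, hshell]
      refine (nextShell_congr fun v _ u hu => hGH _ ⟨u, ?_, by simp⟩).symm
      exact fun h => Set.disjoint_left.1 disjoint_beyond_shell h hu
    exact ⟨by rw [beyond_succ, beyond_succ, hbeyond, hshell_succ], hshell_succ⟩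

lemma ncard_nextShell [Fintype B] :
    ((nextShell G B S).ncard : ℝ) =
      ∑ v : B, {H : SimpleGraph V | ∃ u ∈ S, H.Adj v u}.indicator (fun _ => (1 : ℝ)) G := by
  classical
  have himage : nextShell G B S = Subtype.val '' {v : B | ∃ u ∈ S, G.Adj v u} := by
    ext; simp [nextShell, and_comm]
  simp only [Set.indicator_apply, Set.mem_ofPred_eq]
  rw [Finset.sum_boole, himage, Set.ncard_image_of_injective _ Subtype.val_injective,
    Set.ncard_eq_toFinset_card', Set.toFinset_ofPred]

section FiniteVertices

variable [Finite V] (p : unitInterval)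

lemma ncard_beyond_succ :
    ((beyond G w (s + 1)).ncard : ℝ) = (beyond G w s).ncard - (shell G w (s + 1)).ncard := by
  rw [beyond_succ, ← Set.ncard_sdiff_add_ncard_of_subset shell_succ_subset_beyond]
  push_cast
  ring

lemma binomialRandom_real_inter_nextShell_le (w : V) (s : ℕ) (B S : Set V) (P : Set V → Prop)
    {δ : ℝ} (h : Disjoint B S → G(V, p).real {G | P (nextShell G B S)} ≤ δ) :
    G(V, p).real ({G | beyond G w s = B ∧ shell G w s = S} ∩ {G | P (nextShell G B S)}) ≤
      G(V, p).real {G | beyond G w s = B ∧ shell G w s = S} * δ := by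
  rcases Set.eq_empty_or_nonempty {G : SimpleGraph V | beyond G w s = B ∧ shell G w s = S} with
    hempty | ⟨G, rfl, rfl⟩
  · simp [hempty]
  have hedges : Disjoint {e | ∃ a ∉ beyond G w s ∪ shell G w s, a ∈ e}
      {e | ∃ v ∈ beyond G w s, ∃ u ∈ shell G w s, e = s(v, u)} := by
    rw [Set.disjoint_left]
    rintro _ ⟨a, ha, hae⟩ ⟨v, hv, u, hu, rfl⟩
    rcases Sym2.mem_iff.1 hae with rfl | rfl
    · exact ha (.inl hv)
    · exact ha (.inr hu)
  rw [measureReal_def, (dependsOnEdges_beyond_shell w s _ _).measure_inter p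
    (dependsOnEdges_nextShell P) hedges, ENNReal.toReal_mul]
  exact mul_le_mul_of_nonneg_left (h disjoint_beyond_shell) ENNReal.toReal_nonneg

lemma binomialRandom_real_shell_succ_le (w : V) (s : ℕ) (P : Set V → Set V → Set V → Prop) {δ : ℝ}
    (h : ∀ B S, Disjoint B S → G(V, p).real {G | P B S (nextShell G B S)} ≤ δ) :
    G(V, p).real {G | P (beyond G w s) (shell G w s) (shell G w (s + 1))} ≤ δ := by
  classical
  have := Fintype.ofFinite V
  let state : SimpleGraph V → Set V × Set V := fun G => (beyond G w s, shell G w s)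
  have hfiber : ∀ x, state ⁻¹' {x} = {G | beyond G w s = x.1 ∧ shell G w s = x.2} :=
    fun x => by ext; simp [state, Prod.ext_iff]
  calc G(V, p).real {G | P (beyond G w s) (shell G w s) (shell G w (s + 1))}
      ≤ G(V, p).real (⋃ x, state ⁻¹' {x} ∩ {G | P x.1 x.2 (nextShell G x.1 x.2)}) :=
        measureReal_mono fun G hG => Set.mem_iUnion.2
          ⟨state G, rfl, by rwa [Set.mem_ofPred_eq, shell_succ] at hG⟩
    _ ≤ ∑ x, G(V, p).real (state ⁻¹' {x} ∩ {G | P x.1 x.2 (nextShell G x.1 x.2)}) :=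
        measureReal_iUnion_fintype_le _
    _ ≤ ∑ x, G(V, p).real (state ⁻¹' {x}) * δ := Finset.sum_le_sum fun x _ => by
        rw [hfiber]
        exact binomialRandom_real_inter_nextShell_le p w s x.1 x.2 _ (h x.1 x.2)
    _ = δ := by
        rw [← Finset.sum_mul, sum_measureReal_preimage_singleton _ fun _ _ => .of_discrete]
        simp

lemma iIndepSet_exists_adj (hBS : Disjoint B S) :
    iIndepSet (fun v : B => {G : SimpleGraph V | ∃ u ∈ S, G.Adj v u}) G(V, p) := by
  refine iIndepSet_of_dependsOnEdges p (J := fun v => {e | ∃ u ∈ S, e = s(v.1, u)})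
    (fun v G H hGH ⟨u, hu, hadj⟩ => ⟨u, hu, (hGH s(v.1, u) ⟨u, hu, rfl⟩).1 hadj⟩)
    fun v v' hvv' => Set.disjoint_left.2 ?_
  rintro _ ⟨u, -, rfl⟩ ⟨u', hu', heq⟩
  rcases Sym2.eq_iff.1 heq with ⟨hv, -⟩ | ⟨hv, -⟩
  · exact hvv' (Subtype.ext hv)
  · exact Set.disjoint_left.1 hBS v.2 (hv ▸ hu')

lemma binomialRandom_real_nextShell_deviation_le (hBS : Disjoint B S) {l : ℝ} (hl0 : 0 ≤ l)
    (hl1 : l ≤ 1) (y : ℝ) :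
    G(V, p).real {G |
      l * (B.ncard * ((1 - (1 - p : ℝ) ^ S.ncard) * (1 - p : ℝ) ^ S.ncard)) + y ≤
        |((nextShell G B S).ncard : ℝ) - B.ncard * (1 - (1 - p : ℝ) ^ S.ncard)|} ≤
      2 * Real.exp (-(l * y)) := by
  classical
  have := Fintype.ofFinite V
  have hprob : ∀ v : B, G(V, p).real {G | ∃ u ∈ S, G.Adj v u} = 1 - (1 - p : ℝ) ^ S.ncard :=
    fun v => binomialRandom_real_exists_adj p (Set.disjoint_left.1 hBS v.2)
  have hcard : (Fintype.card B : ℝ) = B.ncard := by rw [← Nat.card_eq_fintype_card]; rfl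
  simpa only [hprob, Finset.sum_const, Finset.card_univ, nsmul_eq_mul, hcard, sub_sub_cancel,
    ← ncard_nextShell] using bernstein_le_abs_sum_indicator_sub (iIndepSet_exists_adj p hBS)
      (fun _ => .of_discrete) hl0 hl1 y

end FiniteVertices

variable [Fintype V]

lemma ncard_beyond_zero : ((beyond G w 0).ncard : ℝ) = Fintype.card V - 1 := by
  have hcard := Set.ncard_add_ncard_compl {w}
  rw [Set.ncard_singleton, Nat.card_eq_fintype_card] at hcard
  rw [beyond_zero, ← hcard]
  push_cast
  ring

lemma binomialRandom_real_ncard_shell_one_le (p : unitInterval) (w : V) {l : ℝ} (hl : 0 ≤ l)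
    (y : ℝ) :
    G(V, p).real {G | ((shell G w 1).ncard : ℝ) ≤ y} ≤
      Real.exp ((Fintype.card V - 1) * p * (Real.exp (-l) - 1) + l * y) := by
  classical
  have hdisjoint : Disjoint {w}ᶜ {w} := Set.disjoint_compl_left_iff_subset.2 subset_rfl
  have hprob : ∀ v : ({w}ᶜ : Set V), G(V, p).real {G | ∃ u ∈ ({w} : Set V), G.Adj v u} = p :=
    fun v => by rw [binomialRandom_real_exists_adj p v.2]; simp
  have hcard : (Fintype.card ({w}ᶜ : Set V) : ℝ) = Fintype.card V - 1 := by
    rw [← ncard_beyond_zero (G := ⊥) (w := w), beyond_zero, ← Nat.card_eq_fintype_card]; rfl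
  have hshell : ∀ G, shell G w 1 = nextShell G {w}ᶜ {w} := fun G => by
    rw [shell_succ, beyond_zero, shell_zero]
  simpa only [hprob, Finset.sum_const, Finset.card_univ, nsmul_eq_mul, hcard, ← ncard_nextShell,
    ← hshell] using
    chernoff_sum_indicator_le (iIndepSet_exists_adj p hdisjoint) (fun _ => .of_discrete) hl y

end Exploration

section HighProbability

variable {d : ℕ → ℝ} {E F : (n : ℕ) → SimpleGraph (Fin n) → Prop}

lemma WHP.mono (hE : WHP d E) (h : ∀ᶠ n in atTop, ∀ G, E n G → F n G) : WHP d F := by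
  refine tendsto_of_tendsto_of_tendsto_of_le_of_le' hE tendsto_const_nhds ?_
    (.of_forall fun n => measureReal_le_one)
  filter_upwards [h] with n hn
  exact measureReal_mono fun G hG => hn G hG

lemma WHP.of_compl_le {f : ℕ → ℝ} (hf : Tendsto f atTop (𝓝 0))
    (h : ∀ᶠ n : ℕ in atTop, G(Fin n, edgeProb (d n / n)).real {G | ¬ E n G} ≤ f n) : WHP d E := by
  have hlower : Tendsto (fun n => 1 - f n) atTop (𝓝 1) := by simpa using hf.const_sub 1
  refine tendsto_of_tendsto_of_tendsto_of_le_of_le' hlower tendsto_const_nhds ?_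
    (.of_forall fun n => measureReal_le_one)
  filter_upwards [h] with n hn
  rw [← Set.compl_ofPred, probReal_compl_eq_one_sub .of_discrete] at hn
  linarith

lemma WHP.and (hE : WHP d E) (hF : WHP d F) : WHP d fun n G => E n G ∧ F n G := by
  have hlim := (hE.const_sub 1).add (hF.const_sub 1)
  rw [sub_self, add_zero] at hlim
  refine .of_compl_le hlim (.of_forall fun n => ?_)
  simp only [not_and_or, Set.ofPred_or]
  refine (measureReal_union_le _ _).trans_eq ?_
  simp only [← Set.compl_ofPred, probReal_compl_eq_one_sub MeasurableSet.of_discrete]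

variable {V : Type*} [Fintype V]

/-- Every shell `V_{s+1}(w)` deviates from its conditional mean given the first `s` shells by no
more than Bernstein's inequality allows. The parameter `ℓ m` of the exponential moment may be
chosen according to the size `m` of `V_s(w)`. -/
def Concentrated (p : ℝ) (ℓ : ℕ → ℝ) (G : SimpleGraph V) : Prop :=
  ∀ w : V, ∀ s ≤ Fintype.card V,
    |((shell G w (s + 1)).ncard : ℝ) -
        (beyond G w s).ncard * (1 - (1 - p) ^ (shell G w s).ncard)| ≤
      ℓ (shell G w s).ncard * ((beyond G w s).ncard *
        ((1 - (1 - p) ^ (shell G w s).ncard) * (1 - p) ^ (shell G w s).ncard)) +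
      3 * Real.log (Fintype.card V) / ℓ (shell G w s).ncard

lemma binomialRandom_real_not_concentrated_le [Nonempty V] (p : unitInterval) {ℓ : ℕ → ℝ}
    (hℓ0 : ∀ m, 0 < ℓ m) (hℓ1 : ∀ m, ℓ m ≤ 1) :
    G(V, p).real {G | ¬ Concentrated p ℓ G} ≤ 4 / Fintype.card V := by
  set L := Real.log (Fintype.card V)
  have hcard : (1 : ℝ) ≤ Fintype.card V := by exact_mod_cast Fintype.card_pos (α := V)
  let deviates (B S T : Set V) : Prop :=
    ℓ S.ncard * (B.ncard * ((1 - (1 - p : ℝ) ^ S.ncard) * (1 - p : ℝ) ^ S.ncard)) +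
      3 * L / ℓ S.ncard ≤ |(T.ncard : ℝ) - B.ncard * (1 - (1 - p : ℝ) ^ S.ncard)|
  have hdeviates : ∀ w s, G(V, p).real
      {G | deviates (beyond G w s) (shell G w s) (shell G w (s + 1))} ≤ 2 * Real.exp (-(3 * L)) :=
    fun w s => binomialRandom_real_shell_succ_le p w s deviates fun B S hBS => by
      simpa only [mul_div_cancel₀ _ (hℓ0 S.ncard).ne'] using
        binomialRandom_real_nextShell_deviation_le p hBS (hℓ0 S.ncard).le (hℓ1 S.ncard)
          (3 * L / ℓ S.ncard)
  have hunion : {G : SimpleGraph V | ¬ Concentrated p ℓ G} ⊆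
      ⋃ x : V × Fin (Fintype.card V + 1),
        {G | deviates (beyond G x.1 x.2) (shell G x.1 x.2) (shell G x.1 (x.2 + 1))} := by
    intro G hG
    simp only [Concentrated, Set.mem_ofPred_eq, not_forall, not_le] at hG
    obtain ⟨w, s, hs, hdev⟩ := hG
    exact Set.mem_iUnion.2 ⟨(w, ⟨s, Nat.lt_succ_of_le hs⟩), hdev.le⟩
  have hexp : Real.exp (-(3 * L)) = 1 / (Fintype.card V : ℝ) ^ 3 := by
    rw [Real.exp_neg, show 3 * L = ((3 : ℕ) : ℝ) * L by norm_num, Real.exp_nat_mul,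
      Real.exp_log (by linarith), one_div]
  calc G(V, p).real {G | ¬ Concentrated p ℓ G}
      ≤ ∑ x : V × Fin (Fintype.card V + 1), 2 * Real.exp (-(3 * L)) :=
        (measureReal_mono hunion).trans <| (measureReal_iUnion_fintype_le _).trans <|
          Finset.sum_le_sum fun x _ => hdeviates x.1 x.2
    _ = 2 * (Fintype.card V + 1) / (Fintype.card V : ℝ) ^ 2 := by
        rw [hexp, Finset.sum_const, Finset.card_univ, Fintype.card_prod, Fintype.card_fin]
        simp only [nsmul_eq_mul, Nat.cast_mul, Nat.cast_add, Nat.cast_one]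
        field_simp
    _ ≤ 4 / Fintype.card V := by
        rw [div_le_div_iff₀ (by positivity) (by positivity)]
        nlinarith

lemma whp_concentrated {ℓ : ℕ → ℝ} (hℓ0 : ∀ m, 0 < ℓ m) (hℓ1 : ∀ m, ℓ m ≤ 1) :
    WHP d fun n G => Concentrated (edgeProb (d n / n)) ℓ G := by
  refine .of_compl_le (tendsto_const_div_atTop_nhds_zero_nat 4) ?_
  filter_upwards [eventually_gt_atTop 0] with n hn
  have : Nonempty (Fin n) := Fin.pos_iff_nonempty.1 hn
  simpa using binomialRandom_real_not_concentrated_le (V := Fin n) (edgeProb (d n / n)) hℓ0 hℓ1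

end HighProbability

section Shells

variable {p : ℝ}

lemma one_sub_pow_le_exp_neg_mul (hp1 : p ≤ 1) (m : ℕ) : (1 - p) ^ m ≤ Real.exp (-(p * m)) := by
  rw [show -(p * m) = m * -p by ring, Real.exp_nat_mul]
  exact pow_le_pow_left₀ (sub_nonneg.2 hp1) (Real.one_sub_le_exp_neg p) m

lemma exp_neg_div_mul_le_one_sub_pow (hp1 : p < 1) (m : ℕ) :
    Real.exp (-(p / (1 - p) * m)) ≤ (1 - p) ^ m := by
  have hp : 0 < 1 - p := sub_pos.2 hp1
  rw [show -(p / (1 - p) * m) = m * -(p / (1 - p)) by ring, Real.exp_nat_mul]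
  refine pow_le_pow_left₀ (Real.exp_nonneg _) ?_ m
  rw [Real.exp_neg, inv_le_comm₀ (Real.exp_pos _) hp]
  calc (1 - p)⁻¹ = p / (1 - p) + 1 := by field_simp; ring
    _ ≤ Real.exp (p / (1 - p)) := Real.add_one_le_exp _

lemma one_sub_one_sub_pow_le (hp1 : p ≤ 1) (m : ℕ) : 1 - (1 - p) ^ m ≤ p * m := by
  have := one_add_mul_le_pow (a := -p) (by linarith) m
  rw [← sub_eq_add_neg] at this
  linarith

lemma mul_one_sub_le_one_sub_one_sub_pow (hp0 : 0 ≤ p) (hp1 : p ≤ 1) (m : ℕ) :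
    p * m * (1 - p * m) ≤ 1 - (1 - p) ^ m := by
  have hx : 0 ≤ p * m := by positivity
  have hexp : Real.exp (-(p * m)) ≤ (1 + p * m)⁻¹ := by
    rw [Real.exp_neg]
    exact inv_anti₀ (by positivity) (by linarith [Real.add_one_le_exp (p * m)])
  have hinv : (1 + p * m)⁻¹ ≤ 1 - p * m * (1 - p * m) := by
    rw [inv_le_iff_one_le_mul₀ (by positivity)]
    nlinarith [mul_nonneg hx (mul_nonneg hx hx)]
  linarith [one_sub_pow_le_exp_neg_mul hp1 m]

variable {V : Type*} [Fintype V] {G : SimpleGraph V} {w : V} {s : ℕ} {ℓ : ℕ → ℝ}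

lemma ncard_beyond_le : ((beyond G w s).ncard : ℝ) ≤ Fintype.card V := by
  exact_mod_cast (Set.ncard_le_card (beyond G w s)).trans_eq Nat.card_eq_fintype_card

lemma Concentrated.abs_ncard_shell_one_sub_le (hG : Concentrated p ℓ G) (hp0 : 0 ≤ p)
    (hℓ : 0 ≤ ℓ 1) (w : V) :
    |((shell G w 1).ncard : ℝ) - (Fintype.card V - 1) * p| ≤
      ℓ 1 * (Fintype.card V * p) + 3 * Real.log (Fintype.card V) / ℓ 1 := by
  have hdev := hG w 0 (Nat.zero_le _)
  simp only [zero_add, shell_zero, Set.ncard_singleton, pow_one, sub_sub_cancel,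
    ncard_beyond_zero] at hdev
  refine hdev.trans (add_le_add_left (mul_le_mul_of_nonneg_left ?_ hℓ) _)
  have hcard : (1 : ℝ) ≤ Fintype.card V :=
    Nat.one_le_cast.2 (Fintype.card_pos_iff.2 ⟨w⟩)
  nlinarith [mul_nonneg (sub_nonneg.2 hcard) (mul_nonneg hp0 hp0)]

lemma abs_mul_one_sub_one_sub_pow_sub_le {n N : ℝ} (hp0 : 0 ≤ p) (hp1 : p ≤ 1) (hN0 : 0 ≤ N)
    (hNn : N ≤ n) (m : ℕ) :
    |N * (1 - (1 - p) ^ m) - n * p * m| ≤ (n - N) * (p * m) + n * (p * m) ^ 2 := by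
  have hpm : 0 ≤ p * m := by positivity
  have hupper := mul_le_mul_of_nonneg_left (one_sub_one_sub_pow_le hp1 m) hN0
  have hlower := mul_le_mul_of_nonneg_left (mul_one_sub_le_one_sub_one_sub_pow hp0 hp1 m) hN0
  have hgap : 0 ≤ (n - N) * (p * m) := mul_nonneg (sub_nonneg.2 hNn) hpm
  have hsq : N * (p * m) ^ 2 ≤ n * (p * m) ^ 2 := by gcongr
  rw [abs_le]
  constructor <;> nlinarith

-- The choice `ℓ m = 1 / √(m + 1)` gives the later, larger shells a smaller relative error.
lemma Concentrated.abs_ncard_shell_succ_sub_le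
    (hG : Concentrated p (fun m => (√(m + 1))⁻¹) G) (hp0 : 0 ≤ p) (hp1 : p ≤ 1)
    (hlog : Real.log (Fintype.card V) ≤ Fintype.card V * p) (hs : s ≤ Fintype.card V)
    (hshell : 1 ≤ (shell G w s).ncard) :
    |((shell G w (s + 1)).ncard : ℝ) - Fintype.card V * p * (shell G w s).ncard| ≤
      (1 - (beyond G w s).ncard / Fintype.card V + p * (shell G w s).ncard +
        7 / √(shell G w s).ncard) * (Fintype.card V * p * (shell G w s).ncard) := by
  have hdev := hG w s hs
  have hN := ncard_beyond_le (G := G) (w := w) (s := s)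
  set n := (Fintype.card V : ℝ)
  set N := ((beyond G w s).ncard : ℝ)
  set m : ℕ := (shell G w s).ncard
  have hn : 0 < n := Nat.cast_pos.2 (Fintype.card_pos_iff.2 ⟨w⟩)
  have hN0 : 0 ≤ N := Nat.cast_nonneg _
  have hm : (1 : ℝ) ≤ m := Nat.one_le_cast.2 hshell
  have hsq : √(m : ℝ) * √m = m := Real.mul_self_sqrt (by linarith)
  have hsqrt_le : √(m : ℝ) ≤ √(m + 1) := Real.sqrt_le_sqrt (by linarith)
  have hsqrt_succ : √((m : ℝ) + 1) ≤ 2 * √m :=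
    Real.sqrt_le_iff.2 ⟨by positivity, by nlinarith⟩
  have hr0 : 0 ≤ (1 - p) ^ m := pow_nonneg (sub_nonneg.2 hp1) m
  have hr1 : (1 - p) ^ m ≤ 1 := pow_le_one₀ (sub_nonneg.2 hp1) (by linarith)
  have hvar : N * ((1 - (1 - p) ^ m) * (1 - p) ^ m) ≤ n * (p * m) := by
    refine mul_le_mul hN ?_ (mul_nonneg (sub_nonneg.2 hr1) hr0) hn.le
    exact (mul_le_of_le_one_right (sub_nonneg.2 hr1) hr1).trans (one_sub_one_sub_pow_le hp1 m)
  have hfluctuation : (√(m + 1))⁻¹ * (N * ((1 - (1 - p) ^ m) * (1 - p) ^ m)) +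
      3 * Real.log n / (√(m + 1))⁻¹ ≤ 7 / √m * (n * p * m) := by
    calc (√(m + 1))⁻¹ * (N * ((1 - (1 - p) ^ m) * (1 - p) ^ m)) + 3 * Real.log n / (√(m + 1))⁻¹
        ≤ (√m)⁻¹ * (n * (p * m)) + 3 * (n * p) * (2 * √m) := by
          rw [div_inv_eq_mul]
          gcongr
      _ = 7 / √m * (n * p * m) := by
          field_simp
          linear_combination 6 * p * hsq
  have hmean := abs_mul_one_sub_one_sub_pow_sub_le hp0 hp1 hN0 hN m
  calc |((shell G w (s + 1)).ncard : ℝ) - n * p * m|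
      ≤ 7 / √m * (n * p * m) + ((n - N) * (p * m) + n * (p * m) ^ 2) :=
        (abs_sub_le _ _ _).trans (add_le_add (hdev.trans hfluctuation) hmean)
    _ = (1 - N / n + p * m + 7 / √m) * (n * p * m) := by field_simp; ring

end Shells

section Growth

lemma relative_error_step {d e x α β c a b : ℝ} (hd : 0 ≤ d) (hα : 0 ≤ α) (hβ : 0 ≤ β)
    (hc : 0 ≤ c) (he : 0 ≤ e) (hx : 0 ≤ x) (hex : e + 2 * x ≤ 1 / 2) (hlower : (1 - e) * α * c ≤ a)
    (hupper : a ≤ (1 + e) * β * c) (hstep : |b - d * a| ≤ x * (d * a)) :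
    (1 - (e + 2 * x)) * α * (d * c) ≤ b ∧ b ≤ (1 + (e + 2 * x)) * β * (d * c) := by
  obtain ⟨hdev_lower, hdev_upper⟩ := abs_le.1 hstep
  constructor
  · calc (1 - (e + 2 * x)) * α * (d * c) ≤ (1 - x) * (1 - e) * α * (d * c) := by
          gcongr
          nlinarith
      _ = (1 - x) * (d * ((1 - e) * α * c)) := by ring
      _ ≤ (1 - x) * (d * a) := by
          gcongr
          linarith
      _ ≤ b := by linarith
  · calc b ≤ (1 + x) * (d * a) := by linarith
      _ ≤ (1 + x) * (d * ((1 + e) * β * c)) := by gcongr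
      _ = (1 + x) * (1 + e) * β * (d * c) := by ring
      _ ≤ (1 + (e + 2 * x)) * β * (d * c) := by
          gcongr
          nlinarith

lemma geometric_growth_of_relative_error {d e ε α β : ℝ} {t : ℕ} {m x : ℕ → ℝ} (hd : 0 < d)
    (hα : 0 ≤ α) (hβ : 0 ≤ β) (he : 0 ≤ e) (hx : ∀ s, 0 ≤ x s)
    (hsum : e + 2 * ∑ r ∈ Finset.Ico 1 t, x r ≤ ε) (hε : ε ≤ 1 / 2)
    (hlower : (1 - e) * α * d ≤ m 1) (hupper : m 1 ≤ (1 + e) * β * d)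
    (hstep : ∀ s, 1 ≤ s → s < t →
      (∀ r, 1 ≤ r → r ≤ s → α / 2 * d ^ r ≤ m r ∧ m r ≤ 2 * β * d ^ r) →
      |m (s + 1) - d * m s| ≤ x s * (d * m s)) :
    ∀ s, 1 ≤ s → s ≤ t → (1 - ε) * α * d ^ s ≤ m s ∧ m s ≤ (1 + ε) * β * d ^ s := by
  set err : ℕ → ℝ := fun s => e + 2 * ∑ r ∈ Finset.Ico 1 s, x r with herr
  have herr_nonneg : ∀ s, 0 ≤ err s := fun s =>
    add_nonneg he (mul_nonneg zero_le_two (Finset.sum_nonneg fun r _ => hx r))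
  have herr_le : ∀ s ≤ t, err s ≤ ε := fun s hs =>
    le_trans (add_le_add_right (mul_le_mul_of_nonneg_left (Finset.sum_le_sum_of_subset_of_nonneg
      (Finset.Ico_subset_Ico_right hs) fun r _ _ => hx r) zero_le_two) e) hsum
  suffices ∀ s, 1 ≤ s → s ≤ t →
      (1 - err s) * α * d ^ s ≤ m s ∧ m s ≤ (1 + err s) * β * d ^ s by
    intro s hs hst
    have hle := herr_le s hst
    exact ⟨le_trans (by gcongr) (this s hs hst).1, (this s hs hst).2.trans (by gcongr)⟩
  intro s
  induction s using Nat.strong_induction_on with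
  | _ s ih =>
    intro hs hst
    obtain rfl | ⟨s, hs1, rfl⟩ : s = 1 ∨ ∃ r, 1 ≤ r ∧ s = r + 1 := by
      rcases hs.eq_or_lt with h | h
      exacts [.inl h.symm, .inr ⟨s - 1, by omega, by omega⟩]
    · simpa [herr] using ⟨hlower, hupper⟩
    have hcrude : ∀ r, 1 ≤ r → r ≤ s → α / 2 * d ^ r ≤ m r ∧ m r ≤ 2 * β * d ^ r := by
      intro r hr hrs
      have hle := herr_le r (by omega)
      obtain ⟨hl, hu⟩ := ih r (by omega) hr (by omega)
      exact ⟨le_trans (by gcongr ?_ * d ^ r; nlinarith) hl, hu.trans (by gcongr; linarith)⟩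
    obtain ⟨hl, hu⟩ := ih s (by omega) hs1 (by omega)
    have herr_succ : err (s + 1) = err s + 2 * x s := by
      simp only [herr, Finset.sum_Ico_succ_top hs1]
      ring
    rw [herr_succ, pow_succ']
    exact relative_error_step hd.le hα hβ (by positivity) (herr_nonneg s) (hx s)
      (herr_succ ▸ (herr_le (s + 1) hst).trans hε) hl hu (hstep s hs1 hst hcrude)

lemma sum_Ico_pow_succ_le {x : ℝ} (hx : 2 ≤ x) (t : ℕ) :
    ∑ r ∈ Finset.Ico 1 t, x ^ (r + 1) ≤ 2 * x ^ t := by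
  induction t with
  | zero => simp
  | succ t ih =>
    have hpow : 2 * x ^ t ≤ x ^ (t + 1) := by
      rw [pow_succ']
      gcongr
    rcases Nat.eq_zero_or_pos t with rfl | ht
    · simp only [zero_add, Finset.Ico_self, Finset.sum_empty]
      positivity
    · rw [Finset.sum_Ico_succ_top ht]
      linarith

lemma sum_Ico_one_pow_le {x : ℝ} (hx0 : 0 ≤ x) (hx : x ≤ 1 / 2) (t : ℕ) :
    ∑ r ∈ Finset.Ico 1 t, x ^ r ≤ 2 * x := by
  refine (geom_sum_Ico_le_of_lt_one hx0 (by linarith)).trans ?_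
  rw [pow_one, div_le_iff₀ (by linarith)]
  nlinarith

variable {V : Type*} [Fintype V] {G : SimpleGraph V} {w : V} {s t : ℕ} {p α β e ε : ℝ}

lemma card_sub_ncard_beyond_le {x : ℝ} (hx : 1 < x) (hβ : 1 ≤ β)
    (h : ∀ r, 1 ≤ r → r ≤ s → ((shell G w r).ncard : ℝ) ≤ β * x ^ r) :
    (Fintype.card V : ℝ) - (beyond G w s).ncard ≤ β * x ^ (s + 1) / (x - 1) := by
  have hx0 : 0 < x - 1 := sub_pos.2 hx
  induction s with
  | zero =>
    rw [ncard_beyond_zero, sub_sub_cancel, zero_add, pow_one, le_div_iff₀ hx0]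
    nlinarith
  | succ s ih =>
    rw [ncard_beyond_succ]
    calc (Fintype.card V : ℝ) - ((beyond G w s).ncard - (shell G w (s + 1)).ncard)
        ≤ β * x ^ (s + 1) / (x - 1) + β * x ^ (s + 1) := by
          linarith [ih fun r hr hrs => h r hr (hrs.trans s.le_succ), h (s + 1) (by omega) le_rfl]
      _ = β * x ^ (s + 1 + 1) / (x - 1) := by field_simp; ring

lemma Concentrated.abs_ncard_shell_succ_sub_le_of_bounds
    (hG : Concentrated p (fun m => (√(m + 1))⁻¹) G) (hp0 : 0 ≤ p) (hp1 : p ≤ 1)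
    (hlog : Real.log (Fintype.card V) ≤ Fintype.card V * p) (hd : 2 ≤ Fintype.card V * p)
    (hα : 0 < α) (hβ : 1 ≤ β) (hs : 1 ≤ s) (hsV : s ≤ Fintype.card V)
    (hlower : α * (Fintype.card V * p) ^ s ≤ (shell G w s).ncard)
    (hupper : ∀ r, 1 ≤ r → r ≤ s → ((shell G w r).ncard : ℝ) ≤ β * (Fintype.card V * p) ^ r) :
    |((shell G w (s + 1)).ncard : ℝ) - Fintype.card V * p * (shell G w s).ncard| ≤
      (2 * β / Fintype.card V * (Fintype.card V * p) ^ (s + 1) +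
        7 / √α * (√(Fintype.card V * p))⁻¹ ^ s) * (Fintype.card V * p * (shell G w s).ncard) := by
  have hn : (0 : ℝ) < Fintype.card V := Nat.cast_pos.2 (Fintype.card_pos_iff.2 ⟨w⟩)
  have hball := card_sub_ncard_beyond_le (by linarith) hβ hupper
  set n := (Fintype.card V : ℝ)
  set m := (shell G w s).ncard
  have hm : 0 < α * (n * p) ^ s := by positivity
  have hexplored : 1 - (beyond G w s).ncard / n ≤ β / n * (n * p) ^ (s + 1) := by
    calc 1 - (beyond G w s).ncard / n = (n - (beyond G w s).ncard) / n := by field_simp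
      _ ≤ β * (n * p) ^ (s + 1) / n := by
          gcongr
          exact hball.trans (div_le_self (by positivity) (by linarith))
      _ = β / n * (n * p) ^ (s + 1) := by ring
  have hcollision : p * m ≤ β / n * (n * p) ^ (s + 1) := by
    calc p * m ≤ p * (β * (n * p) ^ s) := by gcongr; exact hupper s hs le_rfl
      _ = β / n * (n * p) ^ (s + 1) := by field_simp; ring
  have hfluctuation : 7 / √(m : ℝ) ≤ 7 / √α * (√(n * p))⁻¹ ^ s := by
    have hsqrt : √α * √(n * p) ^ s ≤ √m := Real.le_sqrt_of_sq_le <| by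
      rwa [mul_pow, pow_right_comm, Real.sq_sqrt hα.le, Real.sq_sqrt (by linarith)]
    calc 7 / √(m : ℝ) ≤ 7 / (√α * √(n * p) ^ s) := by gcongr
      _ = 7 / √α * (√(n * p))⁻¹ ^ s := by rw [inv_pow, ← div_eq_mul_inv, div_div]
  refine (hG.abs_ncard_shell_succ_sub_le hp0 hp1 hlog hsV
    (Nat.cast_pos.1 (hm.trans_le hlower))).trans ?_
  gcongr
  linarith [show 2 * β / n * (n * p) ^ (s + 1) = 2 * (β / n * (n * p) ^ (s + 1)) by ring]

lemma Concentrated.shell_growth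
    (hG : Concentrated p (fun m => (√(m + 1))⁻¹) G) (hp0 : 0 ≤ p) (hp1 : p ≤ 1)
    (hlog : Real.log (Fintype.card V) ≤ Fintype.card V * p) (hd : 4 ≤ Fintype.card V * p)
    (hα : 0 < α) (hβ : 1 ≤ β) (he : 0 ≤ e) (ht : t ≤ Fintype.card V)
    (hε : e + 16 * β * ((Fintype.card V * p) ^ t / Fintype.card V) +
      28 / √(α / 2) * (√(Fintype.card V * p))⁻¹ ≤ ε) (hε' : ε ≤ 1 / 2)
    (hdeg_lower : (1 - e) * α * (Fintype.card V * p) ≤ (shell G w 1).ncard)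
    (hdeg_upper : (shell G w 1).ncard ≤ (1 + e) * β * (Fintype.card V * p)) :
    ∀ s, 1 ≤ s → s ≤ t → (1 - ε) * α * (Fintype.card V * p) ^ s ≤ (shell G w s).ncard ∧
      (shell G w s).ncard ≤ (1 + ε) * β * (Fintype.card V * p) ^ s := by
  set n := (Fintype.card V : ℝ)
  have hsqrt : (√(n * p))⁻¹ ≤ 1 / 2 := by
    rw [one_div]
    exact inv_anti₀ two_pos (Real.le_sqrt_of_sq_le (by linarith))
  refine geometric_growth_of_relative_error (m := fun s => (shell G w s).ncard)
    (x := fun s => 2 * (2 * β) / n * (n * p) ^ (s + 1) + 7 / √(α / 2) * (√(n * p))⁻¹ ^ s)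
    (by linarith) hα.le (by linarith) he (fun s => by positivity) ?_ hε' hdeg_lower hdeg_upper
    fun s hs hst hbounds => hG.abs_ncard_shell_succ_sub_le_of_bounds hp0 hp1 hlog (by linarith)
      (by linarith) (by linarith) hs (by omega) (hbounds s hs le_rfl).1
      fun r hr hrs => (hbounds r hr hrs).2
  rw [Finset.sum_add_distrib, ← Finset.mul_sum, ← Finset.mul_sum]
  refine le_trans ?_ hε
  calc e + 2 * (2 * (2 * β) / n * ∑ r ∈ Finset.Ico 1 t, (n * p) ^ (r + 1) +
        7 / √(α / 2) * ∑ r ∈ Finset.Ico 1 t, (√(n * p))⁻¹ ^ r)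
      ≤ e + 2 * (2 * (2 * β) / n * (2 * (n * p) ^ t) + 7 / √(α / 2) * (2 * (√(n * p))⁻¹)) := by
        gcongr
        · exact sum_Ico_pow_succ_le (by linarith) t
        · exact sum_Ico_one_pow_le (by positivity) hsqrt t
    _ = _ := by ring

end Growth

section Degrees

/-- The range of the expected degree `d(n)` on which the argument works: at least `log n`, for
the union bounds over vertices, and `o(n)`, so that the edge probability tends to zero. -/
structure DegreeRange (d : ℕ → ℝ) : Prop where
  eventually_log_le : ∀ᶠ n : ℕ in atTop, Real.log n ≤ d n
  isLittleO_natCast : d =o[atTop] fun n : ℕ => (n : ℝ)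

variable {d : ℕ → ℝ} {t : ℕ → ℕ} {α β : ℝ}

namespace DegreeRange

lemma tendsto_atTop (hd : DegreeRange d) : Tendsto d atTop atTop :=
  tendsto_atTop_mono' _ hd.eventually_log_le
    (Real.tendsto_log_atTop.comp tendsto_natCast_atTop_atTop)

lemma tendsto_div (hd : DegreeRange d) : Tendsto (fun n : ℕ => d n / n) atTop (𝓝 0) :=
  hd.isLittleO_natCast.tendsto_div_nhds_zero

lemma eventually_edgeProb_eq (hd : DegreeRange d) :
    ∀ᶠ n : ℕ in atTop, (edgeProb (d n / n) : ℝ) = d n / n := by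
  filter_upwards [hd.tendsto_atTop.eventually_ge_atTop 0,
    hd.tendsto_div.eventually_le_const one_pos] with n hd0 hd1
  exact congrArg Subtype.val (Set.projIcc_of_mem zero_le_one ⟨by positivity, hd1⟩)

lemma eventually_card_mul_edgeProb_eq (hd : DegreeRange d) :
    ∀ᶠ n : ℕ in atTop, (Fintype.card (Fin n) : ℝ) * edgeProb (d n / n) = d n := by
  filter_upwards [hd.eventually_edgeProb_eq, eventually_gt_atTop 0] with n hp hn
  rw [hp, Fintype.card_fin, mul_div_cancel₀ _ (by positivity)]

lemma eventually_exponent_lt (hd : DegreeRange d)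
    (ht : (fun n => d n ^ t n) =o[atTop] fun n : ℕ => (n : ℝ)) : ∀ᶠ n in atTop, t n < n := by
  filter_upwards [hd.tendsto_atTop.eventually_ge_atTop 2, ht.bound one_pos] with n hd2 hn
  rw [one_mul, Real.norm_of_nonneg (by positivity), Real.norm_natCast] at hn
  have hpow : (2 : ℝ) ^ t n ≤ n := (pow_le_pow_left₀ zero_le_two hd2 _).trans hn
  exact (t n).lt_two_pow_self.trans_le (by exact_mod_cast hpow)

end DegreeRange

lemma binomialRandom_real_exists_ncard_shell_one_le {V : Type*} [Fintype V] [Nonempty V]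
    (p : unitInterval) {l : ℝ} (hl : 0 ≤ l) (α : ℝ) :
    G(V, p).real {G | ∃ w, ((shell G w 1).ncard : ℝ) ≤ α * (Fintype.card V * p)} ≤
      Real.exp (Real.log (Fintype.card V) + 1 -
        (1 - Real.exp (-l) - l * α) * (Fintype.card V * p)) := by
  have hmiss : (1 - Real.exp (-l)) * p ≤ 1 :=
    mul_le_one₀ (by linarith [Real.exp_pos (-l)]) p.2.1 p.2.2
  have hcard : (0 : ℝ) < Fintype.card V := Nat.cast_pos.2 Fintype.card_pos
  set n := (Fintype.card V : ℝ)
  rw [Set.ofPred_exists]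
  calc G(V, p).real (⋃ w, {G | ((shell G w 1).ncard : ℝ) ≤ α * (n * p)})
      ≤ ∑ _w : V, Real.exp ((n - 1) * p * (Real.exp (-l) - 1) + l * (α * (n * p))) :=
        (measureReal_iUnion_fintype_le _).trans <| Finset.sum_le_sum fun w _ =>
          binomialRandom_real_ncard_shell_one_le p w hl _
    _ = Real.exp (Real.log n + ((n - 1) * p * (Real.exp (-l) - 1) + l * (α * (n * p)))) := by
        rw [Finset.sum_const, Finset.card_univ, nsmul_eq_mul,
          Real.exp_add (Real.log n), Real.exp_log hcard]
    _ ≤ Real.exp (Real.log n + 1 - (1 - Real.exp (-l) - l * α) * (n * p)) := by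
        gcongr
        linarith

lemma whp_le_ncard_shell_one {c l α : ℝ} (hc : 0 < c) (hl : 0 ≤ l)
    (hα : l * α < 1 - Real.exp (-l) - 1 / c) (hd : DegreeRange d)
    (hcd : ∀ᶠ n : ℕ in atTop, c * Real.log n ≤ d n) :
    WHP d fun n G => ∀ w, α * d n ≤ (shell G w 1).ncard := by
  set κ := 1 - Real.exp (-l) - l * α
  have hκ : 1 / c < κ := by linarith
  have hκ0 : 0 < κ := (one_div_pos.2 hc).trans hκ
  have hlim : Tendsto (fun n : ℕ => Real.exp (1 - (κ * c - 1) * Real.log n)) atTop (𝓝 0) :=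
    Real.tendsto_exp_atBot.comp <| tendsto_atBot_add_const_left _ 1 <|
      tendsto_neg_atTop_atBot.comp <| (Real.tendsto_log_atTop.comp
        tendsto_natCast_atTop_atTop).const_mul_atTop (sub_pos.2 ((div_lt_iff₀ hc).1 hκ))
  refine .of_compl_le hlim ?_
  filter_upwards [hcd, hd.eventually_card_mul_edgeProb_eq, eventually_gt_atTop 0]
    with n hlog hnp hn
  have : Nonempty (Fin n) := Fin.pos_iff_nonempty.1 hn
  have hbound := binomialRandom_real_exists_ncard_shell_one_le (V := Fin n)
    (edgeProb (d n / n)) hl α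
  rw [hnp, Fintype.card_fin] at hbound
  simp only [not_forall, not_le]
  calc G(Fin n, edgeProb (d n / n)).real {G | ∃ w, ((shell G w 1).ncard : ℝ) < α * d n}
      ≤ Real.exp (Real.log n + 1 - κ * d n) :=
        (measureReal_mono (Set.ofPred_subset_ofPred.2 fun G ⟨w, hw⟩ => ⟨w, hw.le⟩)).trans hbound
    _ ≤ Real.exp (1 - (κ * c - 1) * Real.log n) := by
        refine Real.exp_le_exp.2 ?_
        linarith [mul_le_mul_of_nonneg_left hlog hκ0.le]

lemma exists_whp_le_ncard_shell_one {c : ℝ} (hc : 1 < c) :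
    ∃ α > 0, ∀ d, DegreeRange d → (∀ᶠ n : ℕ in atTop, c * Real.log n ≤ d n) →
      WHP d fun n G => ∀ w, α * d n ≤ (shell G w 1).ncard := by
  have hc1 : 1 < 2 * c / (c - 1) := by
    rw [one_lt_div (sub_pos.2 hc)]
    linarith
  set l := Real.log (2 * c / (c - 1)) with hl
  have hl0 : 0 < l := Real.log_pos hc1
  have hgap : 0 < 1 - Real.exp (-l) - 1 / c := by
    rw [Real.exp_neg, hl, Real.exp_log (by linarith), inv_div]
    field_simp
    linarith
  refine ⟨(1 - Real.exp (-l) - 1 / c) / (2 * l), by positivity, fun d hd hcd =>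
    whp_le_ncard_shell_one (by linarith) hl0.le ?_ hd hcd⟩
  rw [mul_div_assoc', div_lt_iff₀ (by positivity)]
  nlinarith

lemma whp_ncard_shell_one_le (hd : DegreeRange d) :
    WHP d fun n G => ∀ w, ((shell G w 1).ncard : ℝ) ≤ 5 * d n := by
  refine (whp_concentrated (ℓ := 1) (fun _ => one_pos) fun _ => le_rfl).mono ?_
  filter_upwards [hd.eventually_card_mul_edgeProb_eq, hd.eventually_log_le] with n hnp hlog G hG w
  have := (abs_le.1 (hG.abs_ncard_shell_one_sub_le (edgeProb _).2.1 zero_le_one w)).2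
  rw [sub_one_mul, hnp, Fintype.card_fin] at this
  simp only [Pi.one_apply] at this
  linarith [(edgeProb (d n / n)).2.1]

lemma shellGrowth_one_of_degree_bounds
    (hlower : WHP d fun n G => ∀ w, α * d n ≤ (shell G w 1).ncard)
    (hupper : WHP d fun n G => ∀ w, ((shell G w 1).ncard : ℝ) ≤ β * d n)
    (hd : DegreeRange d) (hα : 0 ≤ α) (hβ : 0 ≤ β) : ShellGrowth α β d 1 := by
  intro ε hε
  refine (hlower.and hupper).mono ?_
  filter_upwards [hd.tendsto_atTop.eventually_ge_atTop 0] with n hd0 G hG w s hs hs1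
  obtain rfl : s = 1 := le_antisymm hs1 hs
  have hαd := mul_nonneg hε.le (mul_nonneg hα hd0)
  have hβd := mul_nonneg hε.le (mul_nonneg hβ hd0)
  constructor <;> linarith [hG.1 w, hG.2 w]

lemma shellGrowth_one_of_log_isLittleO (hd : DegreeRange d)
    (hlog : (fun n : ℕ => Real.log n) =o[atTop] d) : ShellGrowth 1 1 d 1 := by
  intro ε hε
  set δ := min (ε / 2) 1
  have hδ0 : 0 < δ := by positivity
  have herr : Tendsto (fun n : ℕ => δ + (n : ℝ)⁻¹ + 3 / δ * (Real.log n / d n)) atTop (𝓝 δ) := by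
    simpa using (tendsto_inv_atTop_nhds_zero_nat.const_add δ).add
      (hlog.tendsto_div_nhds_zero.const_mul (3 / δ))
  have hδε : δ < ε := (min_le_left _ _).trans_lt (half_lt_self hε)
  refine (whp_concentrated (ℓ := fun _ => δ) (fun _ => hδ0) fun _ => min_le_right _ _).mono ?_
  filter_upwards [hd.eventually_card_mul_edgeProb_eq, hd.eventually_edgeProb_eq,
    hd.tendsto_atTop.eventually_gt_atTop 0, herr.eventually_le_const hδε]
    with n hnp hp hd0 herr_le G hG w s hs hs1
  obtain rfl : s = 1 := le_antisymm hs1 hs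
  have hdev := abs_le.1 (hG.abs_ncard_shell_one_sub_le (edgeProb _).2.1 hδ0.le w)
  have herr_eq : (δ + (n : ℝ)⁻¹ + 3 / δ * (Real.log n / d n)) * d n =
      δ * d n + d n / n + 3 * Real.log n / δ := by field_simp
  have := herr_eq.symm.trans_le (mul_le_mul_of_nonneg_right herr_le hd0.le)
  rw [sub_one_mul, hnp, hp, Fintype.card_fin] at hdev
  constructor <;> linarith [hdev.1, hdev.2, show 0 ≤ d n / n by positivity]

lemma ShellGrowth.of_one (h : ShellGrowth α β d 1) (hα : 0 < α) (hβ : 1 ≤ β) (hd : DegreeRange d)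
    (ht : (fun n => d n ^ t n) =o[atTop] fun n : ℕ => (n : ℝ)) : ShellGrowth α β d t := by
  intro ε hε
  set δ := min ε (1 / 2)
  have hδ : 0 < δ := by positivity
  have herr : Tendsto (fun n : ℕ => δ / 2 + 16 * β * (d n ^ t n / n) +
      28 / √(α / 2) * (√(d n))⁻¹) atTop (𝓝 (δ / 2)) := by
    simpa using ((ht.tendsto_div_nhds_zero.const_mul (16 * β)).const_add (δ / 2)).add
      ((tendsto_inv_atTop_zero.comp (Real.tendsto_sqrt_atTop.comp hd.tendsto_atTop)).const_mul
        (28 / √(α / 2)))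
  refine ((whp_concentrated (ℓ := fun m => (√(m + 1))⁻¹) (fun m => by positivity) fun m =>
    inv_le_one_of_one_le₀ (Real.one_le_sqrt.2 (by simp))).and (h (δ / 2) (half_pos hδ))).mono ?_
  filter_upwards [hd.eventually_card_mul_edgeProb_eq, hd.eventually_log_le,
    hd.tendsto_atTop.eventually_ge_atTop 4, hd.eventually_exponent_lt ht,
    herr.eventually_le_const (half_lt_self hδ)] with n hnp hlog hd4 htn herr_le G hG w s hs hst
  obtain ⟨hG, hdeg⟩ := hG
  have hdeg := hdeg w 1 le_rfl le_rfl
  have := hG.shell_growth (w := w) (t := t n) (ε := δ) (e := δ / 2) (β := β) (edgeProb _).2.1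
    (edgeProb _).2.2 (by rwa [hnp, Fintype.card_fin]) (by rwa [hnp]) hα hβ (half_pos hδ).le
    (by simpa using htn.le) (by rwa [hnp, Fintype.card_fin]) (min_le_right _ _)
    (by rw [hnp]; simpa using hdeg.1) (by rw [hnp]; simpa using hdeg.2) s hs hst
  rw [hnp] at this
  have hδε : δ ≤ ε := min_le_left _ _
  exact ⟨le_trans (by gcongr) this.1, this.2.trans (by gcongr)⟩

end Degrees

section LastShells

lemma exp_neg_le_exp_neg_mul_add (a : ℝ) {κ : ℝ} (hκ : 1 ≤ κ) :
    Real.exp (-a) ≤ Real.exp (-(κ * a)) + (κ - 1) := by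
  have hsplit : Real.exp (-(κ * a)) = Real.exp (-a) * Real.exp (-((κ - 1) * a)) := by
    rw [← Real.exp_add]
    ring_nf
  have hdecay : Real.exp (-a) * a ≤ 1 := by
    rw [Real.exp_neg, inv_mul_le_one₀ (Real.exp_pos a)]
    linarith [Real.add_one_le_exp a]
  have hlinear := mul_le_mul_of_nonneg_left (Real.one_sub_le_exp_neg ((κ - 1) * a))
    (Real.exp_nonneg (-a))
  nlinarith [mul_le_mul_of_nonneg_left hdecay (sub_nonneg.2 hκ)]

lemma one_sub_pow_bounds_of_mul_bounds {p x y δ : ℝ} {m : ℕ} (hx : 0 ≤ x) (hy : 0 ≤ y)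
    (hδ : 0 ≤ δ) (hδ1 : δ ≤ 1 / 2) (hp : p ≤ δ / 2) (hlower : (1 - δ) * x ≤ p * m)
    (hupper : p * m ≤ (1 + δ) * y) :
    Real.exp (-y) - 2 * δ ≤ (1 - p) ^ m ∧ (1 - p) ^ m ≤ Real.exp (-x) + 2 * δ := by
  have hp1 : 0 < 1 - p := by linarith
  constructor
  · have hy' : p / (1 - p) * m ≤ (1 + 2 * δ) * y := by
      rw [div_mul_eq_mul_div, div_le_iff₀ hp1, mul_right_comm]
      exact hupper.trans (by gcongr; nlinarith)
    calc Real.exp (-y) - 2 * δ ≤ Real.exp (-((1 + 2 * δ) * y)) := by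
          linarith [exp_neg_le_exp_neg_mul_add y (show 1 ≤ 1 + 2 * δ by linarith)]
      _ ≤ Real.exp (-(p / (1 - p) * m)) := by gcongr
      _ ≤ (1 - p) ^ m := exp_neg_div_mul_le_one_sub_pow (by linarith) m
  · have hx' : x ≤ (1 + 2 * δ) * (p * m) := by
      calc x ≤ (1 + 2 * δ) * (1 - δ) * x := le_mul_of_one_le_left hx (by nlinarith)
        _ ≤ (1 + 2 * δ) * (p * m) := by
            rw [mul_assoc]
            gcongr
    calc (1 - p) ^ m ≤ Real.exp (-(p * m)) := one_sub_pow_le_exp_neg_mul (by linarith) m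
      _ ≤ Real.exp (-((1 + 2 * δ) * (p * m))) + 2 * δ := by
          linarith [exp_neg_le_exp_neg_mul_add (p * m) (show 1 ≤ 1 + 2 * δ by linarith)]
      _ ≤ Real.exp (-x) + 2 * δ := by gcongr

/-- The fraction of the vertices that lie beyond the shells `V_0(w), …, V_s(w)`. -/
noncomputable def beyondFraction {n : ℕ} (G : SimpleGraph (Fin n)) (w : Fin n) (s : ℕ) : ℝ :=
  ((beyond G w s).ncard : ℝ) / n

section Fractions

variable {n s : ℕ} {G : SimpleGraph (Fin n)} {w : Fin n} {p δ : ℝ}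

lemma beyondFraction_nonneg : 0 ≤ beyondFraction G w s := by
  unfold beyondFraction
  positivity

lemma beyondFraction_le_one : beyondFraction G w s ≤ 1 :=
  div_le_one_of_le₀ (by simpa using ncard_beyond_le (G := G) (w := w) (s := s)) n.cast_nonneg

lemma shellFraction_succ :
    shellFraction G w (s + 1) = beyondFraction G w s - beyondFraction G w (s + 1) := by
  simp only [shellFraction, beyondFraction, ncard_beyond_succ]
  ring

lemma Concentrated.abs_beyondFraction_succ_sub_le (hG : Concentrated p (fun _ => δ) G)
    (hp0 : 0 ≤ p) (hp1 : p ≤ 1) (hδ : 0 ≤ δ) (hs : s ≤ n) :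
    |beyondFraction G w (s + 1) - beyondFraction G w s * (1 - p) ^ (shell G w s).ncard| ≤
      δ * (1 - p) ^ (shell G w s).ncard + 3 / δ * (Real.log n / n) := by
  have hn : (0 : ℝ) < n := Nat.cast_pos.2 w.pos
  have hdev := hG w s (by simpa using hs)
  rw [Fintype.card_fin] at hdev
  set r := (1 - p) ^ (shell G w s).ncard
  have hr0 : 0 ≤ r := pow_nonneg (sub_nonneg.2 hp1) _
  have hR : beyondFraction G w s * (1 - r) ≤ 1 :=
    mul_le_one₀ beyondFraction_le_one (sub_nonneg.2 (pow_le_one₀ (by linarith) (by linarith)))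
      (by linarith)
  have hsub : beyondFraction G w (s + 1) - beyondFraction G w s * r =
      -(((shell G w (s + 1)).ncard : ℝ) - (beyond G w s).ncard * (1 - r)) / n := by
    simp only [beyondFraction, ncard_beyond_succ]
    ring
  rw [hsub, abs_div, abs_neg, Nat.abs_cast]
  calc |((shell G w (s + 1)).ncard : ℝ) - (beyond G w s).ncard * (1 - r)| / n
      ≤ (δ * ((beyond G w s).ncard * ((1 - r) * r)) + 3 * Real.log n / δ) / n := by gcongr
    _ = δ * (beyondFraction G w s * (1 - r) * r) + 3 / δ * (Real.log n / n) := by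
        unfold beyondFraction
        field_simp
    _ ≤ δ * r + 3 / δ * (Real.log n / n) := by
        gcongr
        exact mul_le_of_le_one_left hr0 hR

lemma Concentrated.beyondFraction_succ_le (hG : Concentrated p (fun _ => δ) G)
    (hp0 : 0 ≤ p) (hp1 : p ≤ 1) (hδ : 0 ≤ δ) (hs : s ≤ n) :
    beyondFraction G w (s + 1) ≤
      (1 + δ) * (1 - p) ^ (shell G w s).ncard + 3 / δ * (Real.log n / n) := by
  have hR := mul_le_of_le_one_left (pow_nonneg (sub_nonneg.2 hp1) (shell G w s).ncard)
    (beyondFraction_le_one (G := G) (w := w) (s := s))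
  linarith [(abs_le.1 (hG.abs_beyondFraction_succ_sub_le (w := w) hp0 hp1 hδ hs)).2]

end Fractions

variable {d : ℕ → ℝ} {t : ℕ → ℕ} {α β a ε : ℝ}

lemma tendsto_log_div_natCast : Tendsto (fun n : ℕ => Real.log n / n) atTop (𝓝 0) :=
  (Real.isLittleO_log_id_atTop.comp_tendsto tendsto_natCast_atTop_atTop).tendsto_div_nhds_zero

lemma ShellGrowth.mono_left (h : ShellGrowth α β d t) (hd : DegreeRange d) (ha0 : 0 ≤ a)
    (ha : a ≤ α) : ShellGrowth a β d t := by
  intro ε hε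
  refine (h ε hε).mono ?_
  filter_upwards [hd.tendsto_atTop.eventually_ge_atTop 0] with n hd0 G hG w s hs hst
  refine ⟨?_, (hG w s hs hst).2⟩
  rcases le_total ε 1 with hε1 | hε1
  · exact le_trans (by gcongr) (hG w s hs hst).1
  · rw [mul_assoc]
    exact (mul_nonpos_of_nonpos_of_nonneg (by linarith) (by positivity)).trans (Nat.cast_nonneg _)

lemma gam_eq_div_mul_pow (n : ℕ) : gam d t n = d n / n * d n ^ t n := by
  rw [gam, pow_succ]
  ring

lemma exists_eventually_le_gam (hd : DegreeRange d) (hγ : (fun _ => (1 : ℝ)) =O[atTop] gam d t) :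
    ∃ g > 0, ∀ᶠ n in atTop, g ≤ gam d t n := by
  obtain ⟨C, hC, hbound⟩ := hγ.exists_pos
  refine ⟨C⁻¹, inv_pos.2 hC, ?_⟩
  filter_upwards [hbound.bound, hd.tendsto_atTop.eventually_ge_atTop 0] with n hn hd0
  rw [norm_one, Real.norm_of_nonneg (by unfold gam; positivity)] at hn
  exact (inv_le_iff_one_le_mul₀' hC).2 hn

lemma eventually_one_le_exponent (hd : DegreeRange d)
    (hγ : (fun _ => (1 : ℝ)) =O[atTop] gam d t) : ∀ᶠ n in atTop, 1 ≤ t n := by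
  obtain ⟨g, hg, hgam⟩ := exists_eventually_le_gam hd hγ
  filter_upwards [hgam, hd.tendsto_div.eventually_lt_const hg] with n hn hdn
  by_contra! ht
  rw [gam, Nat.lt_one_iff.1 ht, zero_add, pow_one] at hn
  exact hdn.not_ge hn

lemma log_isLittleO_pow (hd : DegreeRange d) (hγ : (fun _ => (1 : ℝ)) =O[atTop] gam d t) :
    (fun n : ℕ => Real.log n) =o[atTop] fun n => d n ^ t n := by
  obtain ⟨g, hg, hgam⟩ := exists_eventually_le_gam hd hγ
  have hsq : (fun n : ℕ => (n : ℝ)) =O[atTop] fun n => (d n ^ t n) ^ 2 := by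
    refine .of_bound g⁻¹ ?_
    filter_upwards [hgam, eventually_one_le_exponent hd hγ, eventually_gt_atTop 0,
      hd.tendsto_atTop.eventually_ge_atTop 1] with n hn ht hn0 hd1
    rw [gam, le_div_iff₀ (by positivity)] at hn
    rw [Real.norm_natCast, Real.norm_of_nonneg (by positivity), ← pow_mul,
      le_inv_mul_iff₀ hg]
    exact hn.trans (pow_le_pow_right₀ hd1 (by omega))
  exact (((Real.isLittleO_pow_log_id_atTop (n := 2)).comp_tendsto
    tendsto_natCast_atTop_atTop).trans_isBigO hsq).of_pow two_ne_zero

lemma whp_one_sub_beyondFraction_le (h : ShellGrowth α β d t) (hβ : 1 ≤ β) (hd : DegreeRange d)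
    (hε : 0 < ε) :
    WHP d fun n G => ∀ w, 1 - beyondFraction G w (t n) ≤ (1 + ε) * (β * (d n ^ t n / n)) := by
  have hratio : Tendsto (fun n => (1 + ε / 2) * (1 + (d n - 1)⁻¹)) atTop (𝓝 (1 + ε / 2)) := by
    simpa [sub_eq_add_neg] using ((tendsto_inv_atTop_zero.comp
      (tendsto_atTop_add_const_right _ (-1) hd.tendsto_atTop)).const_add 1).const_mul (1 + ε / 2)
  refine (h (ε / 2) (half_pos hε)).mono ?_
  filter_upwards [hd.tendsto_atTop.eventually_gt_atTop 1,
    hratio.eventually_le_const (show 1 + ε / 2 < 1 + ε by linarith)] with n hd1 hn G hG w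
  have hn0 : (0 : ℝ) < n := Nat.cast_pos.2 w.pos
  have hball := card_sub_ncard_beyond_le (s := t n) hd1 (show 1 ≤ (1 + ε / 2) * β by nlinarith)
    fun r hr hrt => (hG w r hr hrt).2
  rw [Fintype.card_fin] at hball
  calc 1 - beyondFraction G w (t n) = (n - (beyond G w (t n)).ncard) / n := by
        rw [sub_div, div_self hn0.ne', beyondFraction]
    _ ≤ (1 + ε / 2) * β * d n ^ (t n + 1) / (d n - 1) / n := by gcongr
    _ = (1 + ε / 2) * (1 + (d n - 1)⁻¹) * (β * (d n ^ t n / n)) := by field_simp; ring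
    _ ≤ (1 + ε) * (β * (d n ^ t n / n)) := by gcongr

lemma whp_one_sub_le_beyondFraction (h : ShellGrowth α β d t) (hβ : 1 ≤ β) (hd : DegreeRange d)
    (ht : (fun n => d n ^ t n) =o[atTop] fun n : ℕ => (n : ℝ)) (hε : 0 < ε) :
    WHP d fun n G => ∀ w, 1 - ε ≤ beyondFraction G w (t n) := by
  have hlim : Tendsto (fun n => (1 + 1) * (β * (d n ^ t n / n))) atTop (𝓝 0) := by
    simpa using (ht.tendsto_div_nhds_zero.const_mul β).const_mul (1 + 1)
  refine (whp_one_sub_beyondFraction_le h hβ hd one_pos).mono ?_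
  filter_upwards [hlim.eventually_le_const hε] with n hn G hG w
  linarith [hG w]

lemma whp_abs_beyondFraction_succ_sub_le (h : ShellGrowth α β d t) (hβ : 1 ≤ β)
    (hd : DegreeRange d) (ht : (fun n => d n ^ t n) =o[atTop] fun n : ℕ => (n : ℝ)) (hε : 0 < ε) :
    WHP d fun n G => ∀ w, |beyondFraction G w (t n + 1) -
      (1 - edgeProb (d n / n) : ℝ) ^ (shell G w (t n)).ncard| ≤ ε := by
  set δ := min (ε / 3) 1
  have hδ : 0 < δ := by positivity
  have hδε : δ ≤ ε / 3 := min_le_left _ _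
  have hlog := tendsto_log_div_natCast.const_mul (3 / δ)
  rw [mul_zero] at hlog
  refine ((whp_concentrated (ℓ := fun _ => δ) (fun _ => hδ) fun _ => min_le_right _ _).and
    (whp_one_sub_le_beyondFraction h hβ hd ht hδ)).mono ?_
  filter_upwards [hd.eventually_exponent_lt ht, hlog.eventually_le_const hδ]
    with n htn hlogn G hG w
  obtain ⟨hG, hR⟩ := hG
  have hp0 := (edgeProb (d n / n)).2.1
  have hp1 := (edgeProb (d n / n)).2.2
  have hdev := abs_le.1 (hG.abs_beyondFraction_succ_sub_le (w := w) hp0 hp1 hδ.le htn.le)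
  set r := (1 - edgeProb (d n / n) : ℝ) ^ (shell G w (t n)).ncard
  have hr0 : 0 ≤ r := pow_nonneg (sub_nonneg.2 hp1) _
  have hr1 : r ≤ 1 := pow_le_one₀ (sub_nonneg.2 hp1) (by linarith)
  have hR1 := beyondFraction_le_one (G := G) (w := w) (s := t n)
  rw [abs_le]
  constructor <;> nlinarith [hR w, hdev.1, hdev.2]

lemma whp_edgeProb_mul_ncard_shell_bounds (h : ShellGrowth α β d t) (hd : DegreeRange d)
    (ht : ∀ᶠ n in atTop, 1 ≤ t n) (hε : 0 < ε) :
    WHP d fun n G => ∀ w,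
      (1 - ε) * (α * gam d t n) ≤ edgeProb (d n / n) * (shell G w (t n)).ncard ∧
        (edgeProb (d n / n) : ℝ) * (shell G w (t n)).ncard ≤ (1 + ε) * (β * gam d t n) := by
  refine (h ε hε).mono ?_
  filter_upwards [ht, hd.eventually_edgeProb_eq, hd.tendsto_atTop.eventually_ge_atTop 0]
    with n htn hp hd0 G hG w
  obtain ⟨hl, hu⟩ := hG w (t n) htn le_rfl
  have hp0 : 0 ≤ d n / n := by positivity
  rw [hp, gam_eq_div_mul_pow]
  constructor <;> linarith [mul_le_mul_of_nonneg_left hl hp0, mul_le_mul_of_nonneg_left hu hp0]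

lemma whp_one_sub_pow_bounds (h : ShellGrowth α β d t) (hα : 0 ≤ α) (hβ : 0 ≤ β)
    (hd : DegreeRange d) (ht : ∀ᶠ n in atTop, 1 ≤ t n) (hε : 0 < ε) :
    WHP d fun n G => ∀ w, Real.exp (-(β * gam d t n)) - ε ≤
        (1 - edgeProb (d n / n) : ℝ) ^ (shell G w (t n)).ncard ∧
      (1 - edgeProb (d n / n) : ℝ) ^ (shell G w (t n)).ncard ≤
        Real.exp (-(α * gam d t n)) + ε := by
  set δ := min (ε / 2) (1 / 2)
  have hδ : 0 < δ := by positivity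
  have hδε : δ ≤ ε / 2 := min_le_left _ _
  refine (whp_edgeProb_mul_ncard_shell_bounds h hd ht hδ).mono ?_
  filter_upwards [hd.eventually_edgeProb_eq, hd.tendsto_atTop.eventually_ge_atTop 0,
    hd.tendsto_div.eventually_le_const (half_pos hδ)] with n hp hd0 hpδ G hG w
  have hγ0 : 0 ≤ gam d t n := by
    unfold gam
    positivity
  obtain ⟨hl, hu⟩ := one_sub_pow_bounds_of_mul_bounds (mul_nonneg hα hγ0) (mul_nonneg hβ hγ0)
    hδ.le (min_le_right _ _) (hp.trans_le hpδ) (hG w).1 (hG w).2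
  constructor <;> linarith

lemma whp_beyondFraction_succ_bounds (h : ShellGrowth α β d t) (hα : 0 ≤ α) (hβ : 1 ≤ β)
    (hd : DegreeRange d) (ht : (fun n => d n ^ t n) =o[atTop] fun n : ℕ => (n : ℝ))
    (ht1 : ∀ᶠ n in atTop, 1 ≤ t n) (hε : 0 < ε) :
    WHP d fun n G => ∀ w,
      Real.exp (-(β * gam d t n)) - ε ≤ beyondFraction G w (t n + 1) ∧
        beyondFraction G w (t n + 1) ≤ Real.exp (-(α * gam d t n)) + ε := by
  refine ((whp_abs_beyondFraction_succ_sub_le h hβ hd ht (half_pos hε)).and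
    (whp_one_sub_pow_bounds h hα (by linarith) hd ht1 (half_pos hε))).mono
    (.of_forall fun n G hG w => ?_)
  obtain ⟨hdev_lower, hdev_upper⟩ := abs_le.1 (hG.1 w)
  constructor <;> linarith [(hG.2 w).1, (hG.2 w).2]

lemma exists_whp_le_shellFraction_succ (h : ShellGrowth α β d t) (hα : 0 < α) (hβ : 1 ≤ β)
    (hd : DegreeRange d) (ht : (fun n => d n ^ t n) =o[atTop] fun n : ℕ => (n : ℝ))
    (hγ : (fun _ => (1 : ℝ)) =O[atTop] gam d t) :
    ∃ c > 0, WHP d fun n G => ∀ w, c ≤ shellFraction G w (t n + 1) := by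
  obtain ⟨g, hg, hgam⟩ := exists_eventually_le_gam hd hγ
  set c := (1 - Real.exp (-(α * g))) / 3 with hc_def
  have hc : 0 < c :=
    div_pos (sub_pos.2 (Real.exp_lt_one_iff.2 (neg_lt_zero.2 (mul_pos hα hg)))) three_pos
  refine ⟨c, hc, ((whp_one_sub_le_beyondFraction h hβ hd ht hc).and
    (whp_beyondFraction_succ_bounds h hα.le hβ hd ht
      (eventually_one_le_exponent hd hγ) hc)).mono ?_⟩
  filter_upwards [hgam] with n hn G hG w
  have hexp : Real.exp (-(α * gam d t n)) ≤ Real.exp (-(α * g)) := by gcongr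
  rw [shellFraction_succ]
  linarith [hG.1 w, (hG.2 w).2]

lemma whp_beyondFraction_succ_succ_le (h : ShellGrowth α β d t) (hα : 0 < α) (hβ : 1 ≤ β)
    (hd : DegreeRange d) (ht : (fun n => d n ^ t n) =o[atTop] fun n : ℕ => (n : ℝ))
    (hγ : (fun _ => (1 : ℝ)) =O[atTop] gam d t) (hε : 0 < ε) :
    WHP d fun n G => ∀ w, beyondFraction G w (t n + 2) ≤ ε := by
  obtain ⟨c, hc, hwhp⟩ := exists_whp_le_shellFraction_succ h hα hβ hd ht hγ
  have herr : Tendsto (fun n : ℕ => (1 + 1) * Real.exp (-(c * d n)) + 3 * (Real.log n / n))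
      atTop (𝓝 0) := by
    simpa using ((Real.tendsto_exp_neg_atTop_nhds_zero.comp
      (hd.tendsto_atTop.const_mul_atTop hc)).const_mul (1 + 1)).add
      (tendsto_log_div_natCast.const_mul 3)
  refine ((whp_concentrated (ℓ := fun _ => 1) (fun _ => one_pos) fun _ => le_rfl).and
    hwhp).mono ?_
  filter_upwards [herr.eventually_le_const hε, hd.eventually_exponent_lt ht,
    hd.eventually_edgeProb_eq, hd.tendsto_atTop.eventually_ge_atTop 0]
    with n hn htn hp hd0 G hG w
  obtain ⟨hG, hshell⟩ := hG
  have hpow : (1 - edgeProb (d n / n) : ℝ) ^ (shell G w (t n + 1)).ncard ≤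
      Real.exp (-(c * d n)) := by
    refine (one_sub_pow_le_exp_neg_mul (edgeProb _).2.2 _).trans (Real.exp_le_exp.2 (neg_le_neg ?_))
    calc c * d n ≤ shellFraction G w (t n + 1) * d n := by gcongr; exact hshell w
      _ = edgeProb (d n / n) * (shell G w (t n + 1)).ncard := by
          rw [hp, shellFraction]
          ring
  refine (hG.beyondFraction_succ_le (edgeProb _).2.1 (edgeProb _).2.2 zero_le_one htn).trans
    (le_trans ?_ hn)
  rw [div_one]
  gcongr

theorem ShellGrowth.twoLastShells (h : ShellGrowth α β d t) (hα : 0 < α) (hβ : 1 ≤ β)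
    (hd : DegreeRange d) (ht : (fun n => d n ^ t n) =o[atTop] fun n : ℕ => (n : ℝ))
    (hγ : (fun _ => (1 : ℝ)) =O[atTop] gam d t) : TwoLastShells α β d t := by
  intro ε hε
  refine ((whp_one_sub_le_beyondFraction h hβ hd ht (half_pos hε)).and
    ((whp_beyondFraction_succ_bounds h hα.le hβ hd ht
      (eventually_one_le_exponent hd hγ) (half_pos hε)).and
    (whp_beyondFraction_succ_succ_le h hα hβ hd ht hγ (half_pos hε)))).mono
    (.of_forall fun n G hG w => ?_)
  obtain ⟨ht0, ht1, ht2⟩ := hG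
  have hle_one := beyondFraction_le_one (G := G) (w := w) (s := t n)
  have hnonneg := beyondFraction_nonneg (G := G) (w := w) (s := t n + 2)
  rw [shellFraction_succ, shellFraction_succ, abs_le]
  refine ⟨⟨?_, ?_⟩, ⟨?_, ?_⟩, ?_, ?_⟩ <;> linarith [ht0 w, (ht1 w).1, (ht1 w).2, ht2 w]

lemma eventually_mul_log_div_le (hd : DegreeRange d)
    (hγ : (fun _ => (1 : ℝ)) =O[atTop] gam d t) (C : ℝ) (hε : 0 < ε) :
    ∀ᶠ n : ℕ in atTop, C * (Real.log n / n) ≤ ε * (d n ^ t n / n) := by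
  have hlog := (log_isLittleO_pow hd hγ).tendsto_div_nhds_zero.const_mul C
  rw [mul_zero] at hlog
  filter_upwards [hlog.eventually_le_const hε, hd.tendsto_atTop.eventually_gt_atTop 0]
    with n hn hd0
  calc C * (Real.log n / n) = C * (Real.log n / d n ^ t n) * (d n ^ t n / n) := by field_simp
    _ ≤ ε * (d n ^ t n / n) := by gcongr

lemma whp_beyondFraction_succ_le (h : ShellGrowth α β d t) (ha : 0 < a) (haα : a < α)
    (hd : DegreeRange d) (ht : (fun n => d n ^ t n) =o[atTop] fun n : ℕ => (n : ℝ))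
    (hγ : (fun _ => (1 : ℝ)) =O[atTop] gam d t) (hε : 0 < ε) :
    WHP d fun n G => ∀ w, beyondFraction G w (t n + 1) ≤
      (1 + ε) * Real.exp (-(a * gam d t n)) + ε * (d n ^ t n / n) := by
  set δ := min ε 1
  have hδ : 0 < δ := by positivity
  have hα : 0 < α := ha.trans haα
  have hgap : 0 < 1 - a / α := sub_pos.2 ((div_lt_one hα).2 haα)
  refine ((whp_concentrated (ℓ := fun _ => δ) (fun _ => hδ) fun _ => min_le_right _ _).and
    (whp_edgeProb_mul_ncard_shell_bounds h hd (eventually_one_le_exponent hd hγ) hgap)).mono ?_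
  filter_upwards [hd.eventually_exponent_lt ht, eventually_mul_log_div_le hd hγ (3 / δ) hε]
    with n htn hlog G hG w
  have hp1 := (edgeProb (d n / n)).2.2
  have hshell := (hG.2 w).1
  rw [sub_sub_cancel, ← mul_assoc, div_mul_cancel₀ _ hα.ne'] at hshell
  calc beyondFraction G w (t n + 1)
      ≤ (1 + δ) * (1 - edgeProb (d n / n) : ℝ) ^ (shell G w (t n)).ncard +
          3 / δ * (Real.log n / n) :=
        hG.1.beyondFraction_succ_le (edgeProb _).2.1 hp1 hδ.le htn.le
    _ ≤ (1 + ε) * Real.exp (-(a * gam d t n)) + ε * (d n ^ t n / n) := by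
        refine add_le_add (mul_le_mul (by gcongr; exact min_le_left _ _) ?_
          (pow_nonneg (sub_nonneg.2 hp1) _) (by linarith)) hlog
        exact (one_sub_pow_le_exp_neg_mul hp1 _).trans (Real.exp_le_exp.2 (neg_le_neg hshell))

theorem ShellGrowth.oneLastShell (h : ShellGrowth α β d t) (ha : 0 < a) (haα : a < α)
    (hβ : 1 ≤ β) (hd : DegreeRange d)
    (ht : (fun n => d n ^ t n) =o[atTop] fun n : ℕ => (n : ℝ))
    (hγ : (fun _ => (1 : ℝ)) =O[atTop] gam d t) : OneLastShell a β d t := by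
  intro ε hε
  refine ((whp_one_sub_beyondFraction_le h hβ hd (half_pos hε)).and
    (whp_beyondFraction_succ_le h ha haα hd ht hγ (half_pos hε))).mono ?_
  filter_upwards [hd.tendsto_atTop.eventually_gt_atTop 0] with n hd0 G hG w
  have hγd : gam d t n / d n = d n ^ t n / n := by
    rw [gam_eq_div_mul_pow]
    field_simp
  have hratio : 0 ≤ d n ^ t n / n := by positivity
  have hexp := mul_pos hε (Real.exp_pos (-(a * gam d t n)))
  rw [shellFraction_succ, mul_div_assoc, hγd]
  linarith [hG.1 w, hG.2 w, mul_le_mul_of_nonneg_left (le_mul_of_one_le_left hratio hβ) hε.le]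

end LastShells

section Regimes

variable {d : ℕ → ℝ} {c : ℝ}

lemma isLittleO_natCast_of_log_bounds {k : ℕ} (hc : 0 ≤ c)
    (hd : ∀ᶠ n : ℕ in atTop, c * Real.log n ≤ d n ∧ d n ≤ Real.log n ^ k) :
    d =o[atTop] fun n : ℕ => (n : ℝ) := by
  refine IsBigO.trans_isLittleO (.of_bound' ?_)
    ((Real.isLittleO_pow_log_id_atTop (n := k)).comp_tendsto tendsto_natCast_atTop_atTop)
  filter_upwards [hd] with n ⟨hlower, hupper⟩
  rw [Real.norm_of_nonneg ((mul_nonneg hc (Real.log_natCast_nonneg n)).trans hlower)]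
  exact hupper.trans (le_abs_self _)

lemma DegreeRange.of_mul_log_le (hc : 1 ≤ c) (hcd : ∀ᶠ n : ℕ in atTop, c * Real.log n ≤ d n)
    (hd : d =o[atTop] fun n : ℕ => (n : ℝ)) : DegreeRange d where
  eventually_log_le := hcd.mono fun n hn =>
    (le_mul_of_one_le_left (Real.log_natCast_nonneg n) hc).trans hn
  isLittleO_natCast := hd

lemma one_isBigO_of_tendsto_atTop {f : ℕ → ℝ} (hf : Tendsto f atTop atTop) :
    (fun _ => (1 : ℝ)) =O[atTop] f :=
  (isLittleO_const_left.2 (.inr (tendsto_norm_atTop_atTop.comp hf))).isBigO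

end Regimes

end RandomShells

theorem mainTheorem5_general (c : ℝ) (hc : 1 < c) :
    ∃ α β : ℝ, 0 < α ∧ α < 1 ∧ 1 < β ∧
      ∀ (d : ℕ → ℝ) (t : ℕ → ℕ),
        (∀ᶠ n : ℕ in atTop, c * Real.log n ≤ d n) →
        (d =o[atTop] fun n : ℕ => (n : ℝ)) →
        ((fun n : ℕ => d n ^ t n) =o[atTop] fun n : ℕ => (n : ℝ)) →
          RandomShells.ShellGrowth α β d t ∧
          (((fun _ => (1 : ℝ)) =O[atTop] RandomShells.gam d t) →
            RandomShells.TwoLastShells α β d t ∧ RandomShells.OneLastShell α β d t) ∧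
          (((fun n : ℕ => Real.log n) =o[atTop] d) →
            RandomShells.ShellGrowth 1 1 d t ∧
            (((fun _ => (1 : ℝ)) =O[atTop] RandomShells.gam d t) →
              RandomShells.TwoLastShells 1 1 d t ∧
              ∀ a : ℝ, 0 < a → a < 1 → RandomShells.OneLastShell a 1 d t)) := by
  obtain ⟨α₀, hα₀, hdeg⟩ := RandomShells.exists_whp_le_ncard_shell_one hc
  set α := min (α₀ / 2) (1 / 2)
  have hα : 0 < α := by positivity
  have hαα₀ : α < α₀ := (min_le_left _ _).trans_lt (half_lt_self hα₀)
  refine ⟨α, 5, hα, (min_le_right _ _).trans_lt one_half_lt_one, by norm_num,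
    fun d t hcd hdn ht => ?_⟩
  have hd := RandomShells.DegreeRange.of_mul_log_le hc.le hcd hdn
  have hgrowth₀ : RandomShells.ShellGrowth α₀ 5 d t :=
    (RandomShells.shellGrowth_one_of_degree_bounds (hdeg d hd hcd)
      (RandomShells.whp_ncard_shell_one_le hd) hd hα₀.le (by norm_num)).of_one hα₀ (by norm_num)
      hd ht
  have hgrowth : RandomShells.ShellGrowth α 5 d t := hgrowth₀.mono_left hd hα.le hαα₀.le
  refine ⟨hgrowth, fun hγ => ⟨hgrowth.twoLastShells hα (by norm_num) hd ht hγ,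
    hgrowth₀.oneLastShell hα hαα₀ (by norm_num) hd ht hγ⟩, fun hlog => ?_⟩
  have hsharp : RandomShells.ShellGrowth 1 1 d t :=
    (RandomShells.shellGrowth_one_of_log_isLittleO hd hlog).of_one one_pos le_rfl hd ht
  exact ⟨hsharp, fun hγ => ⟨hsharp.twoLastShells one_pos le_rfl hd ht hγ,
    fun a ha ha1 => hsharp.oneLastShell ha ha1 le_rfl hd ht hγ⟩⟩

theorem mainTheorem5 (c : ℝ) (hc : 1 < c) :
    ∃ α β : ℝ, 0 < α ∧ α < 1 ∧ 1 < β ∧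
      ∀ (d : ℕ → ℝ) (t : ℕ → ℕ),
        (∀ᶠ n : ℕ in atTop, c * Real.log n ≤ d n ∧ d n ≤ Real.log n ^ 5) →
        RandomShells.IsLargestExponent d t →
          -- the property of `α` and `β` by which they are chosen
          RandomShells.ShellGrowth α β d t ∧
          -- the case `γ = Θ(1)`
          ((RandomShells.gam d t =Θ[atTop] fun _ => (1 : ℝ)) →
            RandomShells.TwoLastShells α β d t) ∧
          -- the case `γ = ω(1)`
          (Tendsto (RandomShells.gam d t) atTop atTop →
            RandomShells.OneLastShell α β d t) ∧
          -- sharper constants when `d = ω(log n)`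
          (((fun n : ℕ => Real.log n) =o[atTop] d) →
            RandomShells.ShellGrowth 1 1 d t ∧
            ((RandomShells.gam d t =Θ[atTop] fun _ => (1 : ℝ)) →
              RandomShells.TwoLastShells 1 1 d t) ∧
            (Tendsto (RandomShells.gam d t) atTop atTop →
              ∀ a : ℝ, 0 < a → a < 1 → RandomShells.OneLastShell a 1 d t)) := by
  obtain ⟨α, β, hα0, hα1, hβ1, h⟩ := mainTheorem5_general c hc
  refine ⟨α, β, hα0, hα1, hβ1, fun d t hd ht => ?_⟩
  obtain ⟨hgrowth, hlast, hsharp⟩ := h d t (hd.mono fun n hn => hn.1)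
    (RandomShells.isLittleO_natCast_of_log_bounds (zero_le_one.trans hc.le) hd) ht.1
  have hγ_large := RandomShells.one_isBigO_of_tendsto_atTop (f := RandomShells.gam d t)
  exact ⟨hgrowth, fun hγ => (hlast hγ.2).1, fun hγ => (hlast (hγ_large hγ)).2, fun hlog =>
    ⟨(hsharp hlog).1, fun hγ => ((hsharp hlog).2 hγ.2).1,
      fun hγ => ((hsharp hlog).2 (hγ_large hγ)).2⟩⟩
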